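/- For an oriented link $L$ in $S^3$ let $F$ be a connected Seifert surface for $L$, and let the signature $\sigma(L)$ and the nullity $\eta(L)$ be the signature and the dimension of the nullspace of the symmetrised Seifert pairing $H_1(F)\times H_1(F)\to\mathbb Z$, $(a,b)\mapsto \mathrm{lk}(a_+,b)+\mathrm{lk}(a,b_+)$, where $b_+$ is the cycle $b$ pushed off $F$ in the positive normal direction. Lemma. Let $L$ and $L'$ be oriented links in $S^3$. (1) If $L'$ is obtained from $L$ by changing a single negative crossing (in some diagram of $L$), then $$\sigma(L')+\eta(L')\in\{\sigma(L)+\eta(L),\ \sigma(L)+\eta(L)-2\}\quad\text{and}\quad \sigma(L')-\eta(L')\in\{\sigma(L)-\eta(L),\ \sigma(L)-\eta(L)-2\}.$$ (2) If $L'$ is obtained from $L$ by changing a single positive crossing (in some diagram of $L$), then $$\sigma(L')+\eta(L')\in\{\sigma(L)+\eta(L),\ \sigma(L)+\eta(L)+2\}\quad\text{and}\quad \sigma(L')-\eta(L')\in\{\sigma(L)-\eta(L),\ \sigma(L)-\eta(L)+2\}.$$ (3) In either case, $|\eta(L')-\eta(L)|\le 1$. -/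

import Mathlib

/-!
Oriented links in the three-sphere, described by oriented link diagrams up to Reidemeister moves,
and the signature and nullity computed from a connected Seifert surface.

Every crossing is drawn with both strands running upwards.  It has two incoming ends, lower left and
lower right, and two outgoing ends, upper left and upper right.  The strand entering at the lower
left leaves at the upper right, and the strand entering at the lower right leaves at the upper left.
-/

noncomputable section

/-- An oriented signed Gauss code.

A pair `(x, s)` is a *visit*: the passage of the link through the crossing `x` that enters at the
lower left (`s = true`) or at the lower right (`s = false`).  Traversing the link along its
orientation, `succ v` is the visit following `v`.  The crossing is positive (`sign x = 1`) if the
strand entering at the lower left is the over-strand, and negative (`sign x = -1`) otherwise.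
`circles` is the number of link components that meet no crossing at all.

The edges of the diagram are labelled by visits: the edge `v` leaves the crossing `v.1` at the
end of the visit `v` and arrives at the beginning of the visit `succ v`. -/
structure GaussCode where
  Crossing : Type
  [fintypeCrossing : Fintype Crossing]
  [decidableEqCrossing : DecidableEq Crossing]
  succ : Equiv.Perm (Crossing × Bool)
  sign : Crossing → ℤˣ
  circles : ℕ

namespace GaussCode

attribute [instance] GaussCode.fintypeCrossing GaussCode.decidableEqCrossing

variable (G : GaussCode)

/-- The visit to the same crossing by the other strand. -/
def other (v : G.Crossing × Bool) : G.Crossing × Bool := (v.1, !v.2)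

/-- The edge arriving at the lower left of `x`. -/
def inLeft (x : G.Crossing) : G.Crossing × Bool := G.succ.symm (x, true)

/-- The edge arriving at the lower right of `x`. -/
def inRight (x : G.Crossing) : G.Crossing × Bool := G.succ.symm (x, false)

/-- The edge departing at the upper left of `x`. -/
def outLeft (x : G.Crossing) : G.Crossing × Bool := (x, false)

/-- The edge departing at the upper right of `x`. -/
def outRight (x : G.Crossing) : G.Crossing × Bool := (x, true)

/-- Walking around a region of the diagram.  The pair `(e, true)` stands for traversing the edge `e`
along its orientation, `(e, false)` for traversing it backwards, in both cases with the region on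
the left-hand side; `faceStep` turns left at the crossing reached. -/
def faceStep (d : (G.Crossing × Bool) × Bool) : (G.Crossing × Bool) × Bool :=
  if d.2 then
    if (G.succ d.1).2 then (G.outLeft (G.succ d.1).1, true) else (G.inLeft (G.succ d.1).1, false)
  else
    if d.1.2 then (G.inRight d.1.1, false) else (G.outRight d.1.1, true)

/-- The crossing reached by a side of an edge in such a walk. -/
def corner (d : (G.Crossing × Bool) × Bool) : G.Crossing :=
  if d.2 then (G.succ d.1).1 else d.1.1

/-- The regions (faces) of the closed surface obtained by gluing a disc to the four-valent graph
underlying the code along each closed walk around a region. -/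
def Face : Type := Quot fun d d' => G.faceStep d = d'

/-- The connected components of the four-valent graph underlying the code. -/
def Piece : Type := Quot fun x y => ∃ s, (G.succ (x, s)).1 = y

/-- The number of components of the link. -/
def numComponents : ℕ := Nat.card (Quot fun v w => G.succ v = w) + G.circles

/-- The over-strand at a positive crossing enters at the lower left, and at a negative crossing at
the lower right. -/
def IsOver (v : G.Crossing × Bool) : Prop := v.2 = true ↔ G.sign v.1 = 1

/-- The code `H` arises from `G` by deleting the crossings in `S`, where both strands are simply
joined up; components that have lost all their crossings become crossingless circles. -/
def IsDeletion (G H : GaussCode) (S : Set G.Crossing) : Prop :=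
  ∃ ι : H.Crossing → G.Crossing, Function.Injective ι ∧ Set.range ι = Sᶜ ∧
    (∀ x, H.sign x = G.sign (ι x)) ∧
    (∀ v : H.Crossing × Bool, ∃ k : ℕ,
      (G.succ^[k + 1]) (Prod.map ι id v) = Prod.map ι id (H.succ v) ∧
      ∀ j < k, ((G.succ^[j + 1]) (Prod.map ι id v)).1 ∈ S) ∧
    H.numComponents = G.numComponents

end GaussCode

/-- An oriented link diagram in the two-sphere: a Gauss code all of whose connected pieces are
planar, i.e. the Euler characteristic `V - E + F`, with `E = 2 V`, is `2` for every piece. -/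
structure LinkDiagram extends GaussCode where
  planar : Nat.card toGaussCode.Face =
    Nat.card toGaussCode.Crossing + 2 * Nat.card toGaussCode.Piece

/-- The moves generating equivalence of link diagrams. -/
inductive ReidemeisterMove : LinkDiagram → LinkDiagram → Prop
  /-- Renaming the crossings. -/
  | relabel (D D' : LinkDiagram) (h : GaussCode.IsDeletion D.toGaussCode D'.toGaussCode ∅) :
      ReidemeisterMove D D'
  /-- First move: undo a kink, i.e. delete the crossing at the corner of a one-sided region. -/
  | one (D D' : LinkDiagram) (d : (D.Crossing × Bool) × Bool)
      (hface : D.faceStep d = d)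
      (h : GaussCode.IsDeletion D.toGaussCode D'.toGaussCode {D.corner d}) :
      ReidemeisterMove D D'
  /-- Second move: delete the two distinct crossings of a two-sided region one of whose sides lies
  over the other. -/
  | two (D D' : LinkDiagram) (d₀ d₁ : (D.Crossing × Bool) × Bool)
      (h₀ : D.faceStep d₀ = d₁) (h₁ : D.faceStep d₁ = d₀)
      (hne : D.corner d₀ ≠ D.corner d₁)
      (hover : D.IsOver d₀.1 ∧ D.IsOver (D.succ d₀.1))
      (h : GaussCode.IsDeletion D.toGaussCode D'.toGaussCode {D.corner d₀, D.corner d₁}) :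
      ReidemeisterMove D D'
  /-- Third move: in a triangular region with three distinct corners, one side of which is over the
  other two and one side of which is under the other two, every one of the three strands
  interchanges its two visits to the corners. -/
  | three (D D' : LinkDiagram) (d : Fin 3 → (D.Crossing × Bool) × Bool)
      (hface : ∀ i, D.faceStep (d i) = d (i + 1))
      (hne : Function.Injective fun i => D.corner (d i))
      (hover : ∃ i, D.IsOver (d i).1 ∧ D.IsOver (D.succ (d i).1))
      (hunder : ∃ i, ¬ D.IsOver (d i).1 ∧ ¬ D.IsOver (D.succ (d i).1))
      (π : Equiv.Perm (D.Crossing × Bool))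
      (hπ : π = Equiv.swap (d 0).1 (D.succ (d 0).1) * Equiv.swap (d 1).1 (D.succ (d 1).1) *
        Equiv.swap (d 2).1 (D.succ (d 2).1))
      (e : D.Crossing ≃ D'.Crossing)
      (hsign : ∀ x, D'.sign (e x) = D.sign x)
      (hsucc : ∀ v, D'.succ (Prod.map e id (π v)) = Prod.map e id (π (D.succ v)))
      (hcircles : D'.circles = D.circles) :
      ReidemeisterMove D D'

/-- Oriented links in the three-sphere (up to isotopy): diagrams up to Reidemeister moves. -/
def OrientedLink : Type 1 := Quot ReidemeisterMove

namespace LinkDiagram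

open GaussCode

variable (D : LinkDiagram)

/-- The oriented link represented by a diagram. -/
def link : OrientedLink := Quot.mk _ D

/-- Change the crossing `x`: interchange the over-strand and the under-strand. -/
def changeCrossing (x : D.Crossing) : LinkDiagram where
  Crossing := D.Crossing
  succ := D.succ
  sign := Function.update D.sign x (-D.sign x)
  circles := D.circles
  planar := D.planar

/-! ### The Seifert surface

Smoothing all crossings, each crossing `x` is replaced by a left arc, from the edge `inLeft x` to
the edge `outLeft x`, and a right arc, from `inRight x` to `outRight x`, and the diagram becomes a
family of disjoint oriented circles.  Seifert's algorithm gives each of them (and each crossingless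
circle) a disc, and adds, at each crossing `x`, a half-twisted band joining the left arc at `x`
to the right arc at `x`.
-/

/-- The edge following `e` on its Seifert circle. -/
def seifertStep (e : D.Crossing × Bool) : D.Crossing × Bool := D.other (D.succ e)

/-- The Seifert circles that meet a crossing. -/
def SeifertCircle : Type := Quot fun e e' => D.seifertStep e = e'

/-- The graph formed by the Seifert circles and the cores of the bands is a spine of the Seifert
surface with its discs removed.  A `1`-chain `z` on it has the coefficient `z.1 e` on the edge `e`
and `z.2 x` on the core of the band at `x`, which runs from the left to the right. -/
abbrev Chain : Type := (D.Crossing × Bool → ℝ) × (D.Crossing → ℝ)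

/-- The `1`-cycles: the flow is conserved on the left arc and on the right arc at each crossing. -/
def cycles : Submodule ℝ D.Chain where
  carrier := {z | ∀ x, z.1 (D.inLeft x) = z.1 (D.outLeft x) + z.2 x ∧
    z.1 (D.inRight x) + z.2 x = z.1 (D.outRight x)}
  add_mem' {a b} ha hb x := by
    have h1 := ha x
    have h2 := hb x
    simp only [Prod.fst_add, Prod.snd_add, Pi.add_apply]
    constructor <;> linarith [h1.1, h1.2, h2.1, h2.2]
  zero_mem' x := by simp
  smul_mem' c a ha x := by
    have h1 := ha x
    simp only [Prod.smul_fst, Prod.smul_snd, Pi.smul_apply, smul_eq_mul]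
    rw [h1.1, ← h1.2]
    constructor <;> ring

theorem seifertStep_inLeft (x : D.Crossing) : D.seifertStep (D.inLeft x) = D.outLeft x := by
  simp [seifertStep, inLeft, outLeft, other]

theorem seifertStep_inRight (x : D.Crossing) : D.seifertStep (D.inRight x) = D.outRight x := by
  simp [seifertStep, inRight, outRight, other]

theorem circle_inLeft (x : D.Crossing) :
    (Quot.mk _ (D.inLeft x) : D.SeifertCircle) = Quot.mk _ (D.outLeft x) :=
  Quot.sound (D.seifertStep_inLeft x)

theorem circle_inRight (x : D.Crossing) :
    (Quot.mk _ (D.inRight x) : D.SeifertCircle) = Quot.mk _ (D.outRight x) :=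
  Quot.sound (D.seifertStep_inRight x)

open Classical in
/-- A Seifert circle, traversed once. -/
def circleCycle (C : D.SeifertCircle) : D.cycles where
  val := (fun e => if (Quot.mk _ e : D.SeifertCircle) = C then 1 else 0, 0)
  property x := by simp [circle_inLeft, circle_inRight]

/-- The cycles that bound in the Seifert surface: each Seifert circle bounds a disc. -/
def boundaries : Submodule ℝ D.cycles := Submodule.span ℝ (Set.range D.circleCycle)

/-- `linkPush a b` is the linking number of `a` with the cycle obtained from `b` by pushing it off
the Seifert surface in the positive normal direction.

The surface is placed so that near each Seifert circle it is a vertical annulus (the discs closing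
the annuli at their lower ends are nested below) to whose upper end the bands are attached.  The
positive normal points to the left of the Seifert circles, and along the band at `x` it points
upwards near the left arc and downwards near the right arc.  Take `a` close to the upper end of the
annuli and `b` slightly lower.  Then the pushed-off `b` passes over `a` only where it sets out
along the band at `x`: it crosses `a` from left to right just after the band if the half-twist makes
`x` positive, and just before the band if it makes `x` negative. The signed count of these
crossings is the linking number. -/
def linkPush : D.Chain →ₗ[ℝ] D.Chain →ₗ[ℝ] ℝ :=
  LinearMap.mk₂ ℝ
    (fun a b => ∑ x, b.2 x * (if D.sign x = 1 then a.1 (D.outLeft x) else a.1 (D.inLeft x)))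
    (fun a a' b => by
      rw [← Finset.sum_add_distrib]
      refine Finset.sum_congr rfl fun x _ => ?_
      split_ifs <;> simp [mul_add])
    (fun c a b => by
      rw [smul_eq_mul, Finset.mul_sum]
      refine Finset.sum_congr rfl fun x _ => ?_
      split_ifs <;> simp [mul_left_comm])
    (fun a b b' => by
      rw [← Finset.sum_add_distrib]
      refine Finset.sum_congr rfl fun x _ => ?_
      split_ifs <;> simp [add_mul])
    (fun c a b => by
      rw [smul_eq_mul, Finset.mul_sum]
      refine Finset.sum_congr rfl fun x _ => ?_
      split_ifs <;> simp [mul_assoc])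

/-! ### Seifert circles do not link cycles on the surface

The planarity of the diagram enters here, in order to see that the linking pairing is well defined
on homology classes. -/

/-- The region to the left (`true`) or to the right (`false`) of an edge. -/
def side (e : D.Crossing × Bool) (b : Bool) : D.Face := Quot.mk _ (e, b)

theorem side_west (x : D.Crossing) : D.side (D.inLeft x) true = D.side (D.outLeft x) true :=
  Quot.sound (by simp [faceStep, inLeft, outLeft])

theorem side_south (x : D.Crossing) : D.side (D.inRight x) true = D.side (D.inLeft x) false :=
  Quot.sound (by simp [faceStep, inLeft, inRight])

theorem side_east (x : D.Crossing) : D.side (D.outRight x) false = D.side (D.inRight x) false :=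
  Quot.sound (by simp [faceStep, outRight, inRight])

theorem side_north (x : D.Crossing) : D.side (D.outLeft x) false = D.side (D.outRight x) true :=
  Quot.sound (by simp [faceStep, outRight, outLeft])

instance : Finite D.Face := Quot.finite _

instance : Finite D.Piece := Quot.finite _

/-- The difference of a function on the regions across the edges. -/
def jump : (D.Face → ℝ) →ₗ[ℝ] (D.Crossing × Bool → ℝ) where
  toFun h e := h (D.side e true) - h (D.side e false)
  map_add' h h' := by ext e; simp; ring
  map_smul' c h := by ext e; simp; ring

/-- The net flow into the crossings. -/
def inflow : (D.Crossing × Bool → ℝ) →ₗ[ℝ] (D.Crossing → ℝ) where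
  toFun c x := c (D.inLeft x) + c (D.inRight x) - c (D.outLeft x) - c (D.outRight x)
  map_add' h h' := by ext e; simp; ring
  map_smul' c h := by ext e; simp; ring

theorem range_jump_le : LinearMap.range D.jump ≤ LinearMap.ker D.inflow := by
  rintro _ ⟨h, rfl⟩
  ext x
  simp [inflow, jump, side_west, side_south, side_east, side_north]

theorem eq_in (e : D.Crossing × Bool) :
    e = D.inLeft (D.succ e).1 ∨ e = D.inRight (D.succ e).1 := by
  rcases h : D.succ e with ⟨y, b⟩
  cases b
  · exact Or.inr (by simp [inRight, ← h])
  · exact Or.inl (by simp [inLeft, ← h])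

theorem piece_ext {p : D.Crossing → ℝ} (hp : ∀ e, p (D.succ e).1 = p e.1)
    (h0 : ∀ q : D.Piece, p q.out = 0) (x : D.Crossing) : p x = 0 := by
  have key : ∀ x y : D.Crossing, (Quot.mk _ x : D.Piece) = Quot.mk _ y → p x = p y := by
    intro x y hxy
    have := congrArg (Quot.lift p (by rintro a b ⟨s, rfl⟩; exact (hp (a, s)).symm)) hxy
    simpa using this
  rw [← h0 (Quot.mk _ x)]
  exact key _ _ (Quot.out_eq (Quot.mk _ x : D.Piece)).symm

theorem finrank_ker_jump_le :
    Module.finrank ℝ (LinearMap.ker D.jump) ≤ Nat.card D.Piece := by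
  classical
  have := Fintype.ofFinite D.Piece
  have := Fintype.ofFinite D.Face
  let f : (D.Face → ℝ) →ₗ[ℝ] (D.Piece → ℝ) :=
    LinearMap.funLeft ℝ ℝ fun q : D.Piece => D.side (D.outRight q.out) true
  have hinj : Function.Injective (f.comp (LinearMap.ker D.jump).subtype) := by
    rw [← LinearMap.ker_eq_bot, LinearMap.ker_eq_bot']
    rintro ⟨h, hh⟩ hf
    have hj : ∀ e, h (D.side e true) = h (D.side e false) := fun e =>
      sub_eq_zero.1 (congrFun (LinearMap.mem_ker.1 hh) e)
    have hN : ∀ x, h (D.side (D.outLeft x) true) = h (D.side (D.outRight x) true) := fun x => by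
      rw [hj, side_north]
    have hout : ∀ e : D.Crossing × Bool,
        h (D.side e true) = h (D.side (D.outRight e.1) true) := by
      rintro ⟨x, b⟩
      cases b
      · exact hN x
      · rfl
    have hW : ∀ x, h (D.side (D.inLeft x) true) = h (D.side (D.outRight x) true) := fun x => by
      rw [side_west, hN]
    have hE : ∀ x, h (D.side (D.inRight x) true) = h (D.side (D.outRight x) true) := fun x => by
      rw [side_south, ← hj, hW]
    have h0 := D.piece_ext (p := fun x => h (D.side (D.outRight x) true))
      (fun e => by
        show _ = h (D.side (D.outRight e.1) true)
        rw [← hout e]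
        rcases D.eq_in e with he | he
        · conv_rhs => rw [he]
          exact (hW _).symm
        · conv_rhs => rw [he]
          exact (hE _).symm)
      (fun q => congrFun hf q)
    apply Subtype.ext
    funext F
    induction F using Quot.ind with
    | _ d =>
      obtain ⟨e, b⟩ := d
      have h1 : h (D.side e true) = 0 := (hout e).trans (h0 e.1)
      cases b
      · exact (hj e).symm.trans h1
      · exact h1
  have := LinearMap.finrank_le_finrank_of_injective hinj
  rwa [Module.finrank_fintype_fun_eq_card, ← Nat.card_eq_fintype_card] at this

theorem finrank_ker_dual_inflow_le :
    Module.finrank ℝ (LinearMap.ker D.inflow.dualMap) ≤ Nat.card D.Piece := by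
  classical
  have := Fintype.ofFinite D.Piece
  let f : Module.Dual ℝ (D.Crossing → ℝ) →ₗ[ℝ] (D.Piece → ℝ) :=
    { toFun := fun ψ q => ψ (Pi.single q.out 1)
      map_add' := fun _ _ => rfl
      map_smul' := fun _ _ => rfl }
  have hinj : Function.Injective (f.comp (LinearMap.ker D.inflow.dualMap).subtype) := by
    refine (injective_iff_map_eq_zero _).2 ?_
    rintro ⟨ψ, hψ⟩ hf
    have hs : ∀ e : D.Crossing × Bool, D.inflow (Pi.single e 1) =
        Pi.single (D.succ e).1 1 - Pi.single e.1 1 := by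
      intro e
      ext x
      obtain ⟨y, b⟩ := e
      have e1 : (D.inLeft x = (y, b)) ↔ (D.succ (y, b)).1 = x ∧ (D.succ (y, b)).2 = true := by
        rw [inLeft, Equiv.symm_apply_eq, eq_comm, Prod.ext_iff]
      have e2 : (D.inRight x = (y, b)) ↔ (D.succ (y, b)).1 = x ∧ (D.succ (y, b)).2 = false := by
        rw [inRight, Equiv.symm_apply_eq, eq_comm, Prod.ext_iff]
      simp only [inflow, LinearMap.coe_mk, AddHom.coe_mk, Pi.single_apply, e1, e2, outLeft, outRight,
        Prod.mk.injEq, Pi.sub_apply, eq_comm (a := x)]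
      rcases D.succ (y, b) with ⟨z, c⟩
      by_cases h1 : z = x <;> by_cases h2 : y = x <;> cases b <;> cases c <;> simp [h1, h2]
    have h0 := D.piece_ext (p := fun x => ψ (Pi.single x 1))
      (fun e => by
        have := LinearMap.congr_fun (LinearMap.mem_ker.1 hψ) (Pi.single e 1)
        rw [LinearMap.dualMap_apply, hs, map_sub] at this
        exact sub_eq_zero.1 this)
      (fun q => congrFun hf q)
    apply Subtype.ext
    apply LinearMap.pi_ext'
    intro x
    ext
    exact h0 x
  have := LinearMap.finrank_le_finrank_of_injective hinj
  rwa [Module.finrank_fintype_fun_eq_card, ← Nat.card_eq_fintype_card] at this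

theorem range_jump : LinearMap.range D.jump = LinearMap.ker D.inflow := by
  classical
  have := Fintype.ofFinite D.Face
  apply Submodule.eq_of_le_of_finrank_le D.range_jump_le
  have h1 := LinearMap.finrank_range_add_finrank_ker D.jump
  have h2 := LinearMap.finrank_range_add_finrank_ker D.inflow
  have h3 := LinearMap.finrank_range_add_finrank_ker D.inflow.dualMap
  have h4 := LinearMap.finrank_range_dualMap_eq_finrank_range D.inflow
  have h5 := D.finrank_ker_jump_le
  have h6 := D.finrank_ker_dual_inflow_le
  have h7 := D.planar
  rw [Module.finrank_fintype_fun_eq_card, ← Nat.card_eq_fintype_card] at h1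
  rw [Module.finrank_fintype_fun_eq_card, ← Nat.card_eq_fintype_card, Nat.card_prod,
    Nat.card_eq_fintype_card (α := Bool), Fintype.card_bool] at h2
  rw [Subspace.dual_finrank_eq, Module.finrank_fintype_fun_eq_card,
    ← Nat.card_eq_fintype_card] at h3
  omega

theorem linkPush_circle_left (C : D.SeifertCircle) (b : D.cycles) :
    D.linkPush (D.circleCycle C).1 b.1 = 0 := by
  classical
  let c : D.Crossing × Bool → ℝ := (D.circleCycle C).1.1
  have hL : ∀ x, c (D.inLeft x) = c (D.outLeft x) := fun x => by
    simp [c, circleCycle, circle_inLeft]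
  have hR : ∀ x, c (D.inRight x) = c (D.outRight x) := fun x => by
    simp [c, circleCycle, circle_inRight]
  have hc : c ∈ LinearMap.range D.jump := by
    rw [D.range_jump, LinearMap.mem_ker]
    ext x
    simp [inflow, hL, hR]
  obtain ⟨h, hh⟩ := hc
  have hj : ∀ e, c e = h (D.side e true) - h (D.side e false) := fun e => by
    rw [← hh]; rfl
  let u : D.Crossing × Bool → ℝ := fun e => - h (D.side e true)
  have uL : ∀ x, u (D.inLeft x) = u (D.outLeft x) := fun x => by simp [u, side_west]
  have uR : ∀ x, u (D.inRight x) = u (D.outRight x) := fun x => by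
    have h1 := hj (D.inRight x)
    have h2 := hj (D.outRight x)
    rw [hR, ← side_east] at h1
    simp only [u]
    linarith
  have hu : ∀ x, c (D.outLeft x) = u (D.outRight x) - u (D.outLeft x) := fun x => by
    have h1 := hj (D.outLeft x)
    rw [side_north] at h1
    simp only [u]
    linarith
  have e1 : D.linkPush (D.circleCycle C).1 b.1 =
      ∑ x, b.1.2 x * (u (D.outRight x) - u (D.outLeft x)) := by
    simp only [linkPush, LinearMap.mk₂_apply]
    refine Finset.sum_congr rfl fun x _ => ?_
    rw [← hu]
    split_ifs
    · rfl
    · rw [← hL]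
  have hb : ∀ x, b.1.2 x * (u (D.outRight x) - u (D.outLeft x)) =
      (b.1.1 (D.outLeft x) * u (D.outLeft x) + b.1.1 (D.outRight x) * u (D.outRight x)) -
      (b.1.1 (D.inLeft x) * u (D.inLeft x) + b.1.1 (D.inRight x) * u (D.inRight x)) := fun x => by
    obtain ⟨h1, h2⟩ := b.2 x
    rw [uL, uR, h1, ← h2]
    ring
  have hsum : ∀ F : D.Crossing × Bool → ℝ,
      ∑ x, (F (D.outLeft x) + F (D.outRight x)) = ∑ x, (F (D.inLeft x) + F (D.inRight x)) := by
    intro F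
    have s1 : ∑ e, F e = ∑ x, (F (D.outLeft x) + F (D.outRight x)) := by
      rw [Fintype.sum_prod_type]
      refine Finset.sum_congr rfl fun x _ => ?_
      rw [Fintype.sum_bool, add_comm]; rfl
    have s2 : ∑ e, F (D.succ.symm e) = ∑ x, (F (D.inLeft x) + F (D.inRight x)) := by
      rw [Fintype.sum_prod_type]
      refine Finset.sum_congr rfl fun x _ => ?_
      rw [Fintype.sum_bool]; rfl
    rw [← s1, ← s2, Equiv.sum_comp]
  rw [e1, Finset.sum_congr rfl fun x _ => hb x, Finset.sum_sub_distrib,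
    hsum fun e => b.1.1 e * u e, sub_self]

theorem linkPush_circle_right (C : D.SeifertCircle) (a : D.cycles) :
    D.linkPush a.1 (D.circleCycle C).1 = 0 := by
  simp [linkPush, circleCycle]

/-- The first homology (with real coefficients) of the surface made of the discs and the bands. -/
abbrev DiscBandHomology : Type := D.cycles ⧸ D.boundaries

/-- The linking number of a class with the positive push-off of another one, in the surface made of
the discs and the bands. -/
def discBandPairing : LinearMap.BilinForm ℝ D.DiscBandHomology :=
  D.boundaries.liftQ
    (LinearMap.flip (D.boundaries.liftQ
      (LinearMap.flip (D.linkPush.domRestrict₁₂ D.cycles D.cycles))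
      (Submodule.span_le.2 (by
        rintro _ ⟨C, rfl⟩
        exact LinearMap.ext fun a => D.linkPush_circle_right C a))))
    (Submodule.span_le.2 (by
      rintro _ ⟨C, rfl⟩
      apply LinearMap.ext
      intro b
      induction b using Submodule.Quotient.induction_on with
      | _ b => exact D.linkPush_circle_left C b))

/-- The number of connected components of the surface made of the discs and the bands. -/
def numPieces : ℕ := Nat.card D.Piece + D.circles

/-- The first homology of the connected Seifert surface obtained by joining the components of the
surface made of the discs and the bands by `numPieces - 1` tubes.  Each tube adds one generator,
its meridian. -/
abbrev SeifertHomology : Type := D.DiscBandHomology × (Fin (D.numPieces - 1) → ℝ)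

/-- The Seifert pairing `(a, b) ↦ lk (a, b₊)` of the connected Seifert surface.  The meridian of a
tube does not link any cycle on the surface. -/
def seifertPairing : LinearMap.BilinForm ℝ D.SeifertHomology :=
  D.discBandPairing.compl₁₂ (LinearMap.fst ℝ _ _) (LinearMap.fst ℝ _ _)

/-- The symmetrised Seifert pairing `(a, b) ↦ lk (a₊, b) + lk (a, b₊)`. -/
def symmetrisedPairing : LinearMap.BilinForm ℝ D.SeifertHomology :=
  D.seifertPairing.flip + D.seifertPairing

/-- The signature of the symmetrised Seifert pairing. -/
def signature : ℤ :=
  (sigPos D.symmetrisedPairing.toQuadraticMap : ℤ) - sigNeg D.symmetrisedPairing.toQuadraticMap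

/-- The dimension of the nullspace of the symmetrised Seifert pairing. -/
def nullity : ℤ := Module.finrank ℝ (LinearMap.ker D.symmetrisedPairing)

end LinkDiagram

/-- The link `L'` is obtained from `L` by changing a single crossing of sign `ε` in some diagram
of `L`. -/
def OrientedLink.CrossingChange (ε : ℤˣ) (L L' : OrientedLink) : Prop :=
  ∃ (D : LinkDiagram) (x : D.Crossing), D.sign x = ε ∧ D.link = L ∧ (D.changeCrossing x).link = L'

end

/-! The crossing change itself is short. Seifert's algorithm yields the same discs and bands before
and after the change; only the half-twist of one band is reversed. If `φ` is the multiplicity with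
which a class runs through that band and `ε` is the old sign of the crossing, the symmetrised forms
satisfy `Q' = Q + 2 ε φ²`. Such a perturbation moves each of the two indices by at most one, in a
direction dictated by `ε` (`sig_sub_sq`). On a space of dimension `d`, signature plus nullity is `d`
minus twice the negative index, and signature minus nullity is twice the positive index minus `d`.
This gives the first two claims, and their difference gives the third.

The bulk of the work shows that signature and nullity depend only on the link, because the crossing
is changed in some diagram unrelated to the given ones. Seifert surfaces behave badly under
Reidemeister moves, so both invariants are first expressed by the Goeritz form of a checkerboard
colouring, as Gordon and Litherland do (`signature_nullity_eq`). By planarity every cycle of the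
Seifert graph is the difference across edges of a function on the regions, that is, of a black
function `f` and a white function `g`. Completing a square at each crossing whose left and right
regions are white exhibits the self-linking form as the pullback, along `splitting`, of the Goeritz
form in `g` plus a diagonal form with entries `±1` (`linkPush_cycleOf`). The image of `splitting`
contains its own orthogonal complement (`splitting_coisotropic`), and passing to such a subspace
lowers both indices by its codimension, so the signature is unaffected and the nullity is found by
counting dimensions. The coisotropy rests on a discrete duality: up to signs, gradients of white
functions are exactly the annihilator of gradients of black functions (`exists_drop_eq`).

The moves are then local computations with Goeritz forms. For the first two moves the vanishing
region is coloured black, and the deleted crossings contribute zero or cancel (`Deletion.goeritz`).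
For the third move the triangle is coloured white, and the move becomes a star–triangle
transformation: the form gains or loses one square with coefficient `±1`, which the correction term
compensates (`star_triangle`, `TriangleMove.goeritz_invariants`). -/

noncomputable section

/-! ### Indices of real quadratic forms -/

section Signature

open Module

variable {V W : Type*} [AddCommGroup V] [Module ℝ V] [FiniteDimensional ℝ V]
  [AddCommGroup W] [Module ℝ W] [FiniteDimensional ℝ W]

/-- A linear map along which `Q` pulls back to a form at most `R` cannot lower the signature. -/
theorem sigPos_le_of_comp_le (Q : QuadraticForm ℝ V) (R : QuadraticForm ℝ W) (f : V →ₗ[ℝ] W)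
    (h : ∀ v, Q v ≤ R (f v)) : sigPos Q ≤ sigPos R := by
  obtain ⟨U, hU, hpos⟩ := exists_finrank_eq_sigPos_and_posDef Q
  have hp : ∀ u ∈ U, u ≠ 0 → 0 < R (f u) := fun u hu h0 =>
    (hpos ⟨u, hu⟩ (by simpa using h0)).trans_le (h u)
  have hinj : Function.Injective (f.domRestrict U) := by
    rw [← LinearMap.ker_eq_bot, LinearMap.ker_eq_bot']
    rintro ⟨u, hu⟩ h0
    by_contra hne
    have h1 := hp u hu (by simpa using hne)
    rw [show f u = 0 from h0, QuadraticMap.map_zero] at h1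
    exact lt_irrefl _ h1
  have h1 : finrank ℝ (U.map f) = finrank ℝ U := by
    rw [← LinearMap.range_domRestrict]
    exact LinearMap.finrank_range_of_inj hinj
  rw [← hU, ← h1]
  apply le_sigPos_of_posDef
  rintro ⟨_, u, hu, rfl⟩ hne
  exact hp u hu fun h0 => hne (by simp [h0])

/-- A linear section of `f` pulls `Q.comp f` back to `Q`, so monotonicity applies in both
directions. -/
theorem sigPos_comp_of_surjective (Q : QuadraticForm ℝ W) (f : V →ₗ[ℝ] W)
    (hf : Function.Surjective f) : sigPos (Q.comp f) = sigPos Q := by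
  obtain ⟨g, hg⟩ := f.exists_rightInverse_of_surjective (LinearMap.range_eq_top.2 hf)
  refine le_antisymm (sigPos_le_of_comp_le _ _ f fun v => le_rfl)
    (sigPos_le_of_comp_le _ _ g fun w => ?_)
  simp [← LinearMap.comp_apply f g, hg]

theorem sigNeg_comp_of_surjective (Q : QuadraticForm ℝ W) (f : V →ₗ[ℝ] W)
    (hf : Function.Surjective f) : sigNeg (Q.comp f) = sigNeg Q :=
  sigPos_comp_of_surjective (-Q) f hf

/-- Restricting a form to a subspace of codimension `c` lowers the signature by at most `c`. -/
theorem sigPos_le_of_submodule (Q : QuadraticForm ℝ V) (R : QuadraticForm ℝ W) (I : Submodule ℝ V)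
    (f : I →ₗ[ℝ] W) (h : ∀ v : I, Q v ≤ R (f v)) (c : ℕ) (hc : finrank ℝ V ≤ finrank ℝ I + c) :
    sigPos Q ≤ sigPos R + c := by
  obtain ⟨U, hU, hpos⟩ := exists_finrank_eq_sigPos_and_posDef Q
  have h1 : (Q.restrict (U ⊓ I)).PosDef := fun x hx =>
    hpos ⟨x.1, x.2.1⟩ fun h => by
      have h' := congrArg Subtype.val h
      exact hx (Subtype.ext h')
  have h2 : sigPos (Q.restrict I) ≤ sigPos R := sigPos_le_of_comp_le _ _ f h
  have h3 : finrank ℝ ↥(U ⊓ I) ≤ sigPos (Q.restrict I) := by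
    have h4 : finrank ℝ ((U ⊓ I).comap I.subtype) = finrank ℝ ↥(U ⊓ I) := by
      have : (U ⊓ I) ≤ I := inf_le_right
      exact (Submodule.comapSubtypeEquivOfLe this).finrank_eq
    rw [← h4]
    apply le_sigPos_of_posDef
    rintro ⟨x, hx⟩ hne
    exact h1 ⟨x.1, hx⟩ fun h => by
      have h' := congrArg Subtype.val h
      exact hne (Subtype.ext (Subtype.ext h'))
  have h5 := Submodule.finrank_sup_add_finrank_inf_eq U I
  have h6 := (U ⊔ I).finrank_le
  omega

/-- Pulling back a form to a coisotropic subspace of codimension `c` lowers both indices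
by `c`. -/
theorem sig_comp_of_coisotropic (K : QuadraticForm ℝ W) (T : V →ₗ[ℝ] W) (c : ℕ)
    (hc : finrank ℝ T.range + c = finrank ℝ W)
    (hco : ∀ w, (∀ v, QuadraticMap.polar K w (T v) = 0) → w ∈ T.range) :
    sigPos K = sigPos (K.comp T) + c ∧ sigNeg K = sigNeg (K.comp T) + c := by
  have hs : sigPos (K.comp T) = sigPos (K.restrict T.range) ∧
      sigNeg (K.comp T) = sigNeg (K.restrict T.range) := by
    rw [← sigPos_comp_of_surjective (K.restrict T.range) T.rangeRestrict T.surjective_rangeRestrict,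
      ← sigNeg_comp_of_surjective (K.restrict T.range) T.rangeRestrict T.surjective_rangeRestrict]
    exact ⟨rfl, rfl⟩
  rw [hs.1, hs.2]
  set I := T.range with hI
  have hp : sigPos K ≤ sigPos (K.restrict I) + c :=
    sigPos_le_of_submodule K _ I LinearMap.id (fun _ => le_rfl) c (by omega)
  have hn : sigNeg K ≤ sigNeg (K.restrict I) + c :=
    sigPos_le_of_submodule (-K) (-K.restrict I) I LinearMap.id (fun _ => le_rfl) c (by omega)
  have htK := QuadraticForm.sigPos_add_sigNeg_add_radical (Q := K)
  have htI := QuadraticForm.sigPos_add_sigNeg_add_radical (Q := K.restrict I)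
  have : Invertible (2 : ℝ) := invertibleOfNonzero two_ne_zero
  let B : LinearMap.BilinForm ℝ W := K.polarBilin
  have hB : B.IsRefl := fun x y h => by
    simpa [B, QuadraticMap.polar_comm] using h
  have hperp : B.orthogonal I ≤ I := fun w hw => hco w fun v => by
    rw [QuadraticMap.polar_comm]
    exact hw (T v) ⟨v, rfl⟩
  have hker : LinearMap.ker B ≤ I := fun w hw => hco w fun v => by
    have := LinearMap.congr_fun (LinearMap.mem_ker.1 hw) (T v)
    simpa [B] using this
  -- The orthogonal complement of `I` has dimension `c` plus that of the radical of `K`, and it lies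
  -- in the radical of the restriction. Hence the sum of the two indices drops by at least `2 c`,
  -- while each index drops by at most `c`, so both drop by exactly `c`.
  have hd := LinearMap.BilinForm.finrank_add_finrank_orthogonal' (B := B) I
  rw [inf_eq_right.2 hker, ← QuadraticMap.radical_eq_ker_polarBilin] at hd
  have hrad : finrank ℝ (B.orthogonal I) ≤ finrank ℝ (K.restrict I).radical := by
    rw [QuadraticMap.radical_eq_ker_polarBilin,
      ← (Submodule.comapSubtypeEquivOfLe hperp).finrank_eq]
    apply Submodule.finrank_mono
    rintro ⟨w, hwI⟩ hw
    rw [LinearMap.mem_ker]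
    ext ⟨v, hv⟩
    have h2 : QuadraticMap.polar K v w = 0 := hw v hv
    rw [QuadraticMap.polar_comm] at h2
    exact h2
  omega

theorem finrank_submodule_prod (U : Submodule ℝ V) (U' : Submodule ℝ W) :
    finrank ℝ (U.prod U') = finrank ℝ U + finrank ℝ U' := by
  have h : (LinearMap.prodMap U.subtype U'.subtype).range = U.prod U' := by
    ext ⟨u, u'⟩
    simp
  rw [← h, LinearMap.finrank_range_of_inj, finrank_prod]
  exact U.subtype_injective.prodMap U'.subtype_injective

/-- Both indices and the dimension of the radical are superadditive. Each triple adds up to the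
dimension, which is additive, so all three inequalities are equalities. -/
theorem sig_prod (Q : QuadraticForm ℝ V) (R : QuadraticForm ℝ W) :
    sigPos (QuadraticMap.prod Q R) = sigPos Q + sigPos R ∧
      sigNeg (QuadraticMap.prod Q R) = sigNeg Q + sigNeg R := by
  have key : ∀ (Q : QuadraticForm ℝ V) (R : QuadraticForm ℝ W),
      sigPos Q + sigPos R ≤ sigPos (QuadraticMap.prod Q R) := by
    intro Q R
    obtain ⟨U, hU, hQ⟩ := exists_finrank_eq_sigPos_and_posDef Q
    obtain ⟨U', hU', hR⟩ := exists_finrank_eq_sigPos_and_posDef R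
    rw [← hU, ← hU', ← finrank_submodule_prod]
    apply le_sigPos_of_posDef
    rintro ⟨⟨u, u'⟩, hu, hu'⟩ hne
    have hq : u ≠ 0 → 0 < Q u := fun h => hQ ⟨u, hu⟩ (by simpa using h)
    have hr : u' ≠ 0 → 0 < R u' := fun h => hR ⟨u', hu'⟩ (by simpa using h)
    show 0 < Q u + R u'
    by_cases h0 : u = 0
    · by_cases h0' : u' = 0
      · exact absurd (by simp [h0, h0']) hne
      · simpa [h0] using hr h0'
    · by_cases h0' : u' = 0
      · simpa [h0'] using hq h0
      · exact add_pos (hq h0) (hr h0')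
  have hp := key Q R
  have hn : sigNeg Q + sigNeg R ≤ sigNeg (QuadraticMap.prod Q R) := by
    refine (key (-Q) (-R)).trans_eq ?_
    rw [← sigPos_neg]
    congr 1
    ext x
    simp [add_comm]
  have tQ := QuadraticForm.sigPos_add_sigNeg_add_radical (Q := Q)
  have tR := QuadraticForm.sigPos_add_sigNeg_add_radical (Q := R)
  have tP := QuadraticForm.sigPos_add_sigNeg_add_radical (Q := QuadraticMap.prod Q R)
  have hr : finrank ℝ Q.radical + finrank ℝ R.radical ≤
      finrank ℝ (QuadraticMap.prod Q R).radical := by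
    rw [← finrank_submodule_prod]
    apply Submodule.finrank_mono
    rintro ⟨u, u'⟩ ⟨hu, hu'⟩
    simp only [SetLike.mem_coe, QuadraticMap.mem_radical_iff'] at hu hu' ⊢
    simp [hu.1, hu.2, hu'.1, hu'.2]
  rw [finrank_prod] at tP
  omega

end Signature

/-- A rank one perturbation `Q' = Q - 2 φ²`. -/
theorem sig_sub_sq {V : Type*} [AddCommGroup V] [Module ℝ V] [FiniteDimensional ℝ V]
    (Q Q' : QuadraticForm ℝ V) (φ : V →ₗ[ℝ] ℝ) (h : ∀ v, Q' v = Q v - 2 * (φ v * φ v)) :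
    (sigPos Q = sigPos Q' ∨ sigPos Q = sigPos Q' + 1) ∧
      (sigNeg Q' = sigNeg Q ∨ sigNeg Q' = sigNeg Q + 1) := by
  have hk : Module.finrank ℝ V ≤ Module.finrank ℝ φ.ker + 1 := by
    have h1 := φ.finrank_range_add_finrank_ker
    have h2 := φ.range.finrank_le
    rw [Module.finrank_self] at h2
    omega
  have hz : ∀ v : φ.ker, φ v = 0 := fun v => v.2
  -- `Q' ≤ Q` everywhere gives monotonicity of the indices, and `Q' = Q` on the hyperplane (or whole
  -- space) `ker φ` bounds the change by one.
  have h1 : sigPos Q' ≤ sigPos Q := sigPos_le_of_comp_le _ _ LinearMap.id fun v => by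
    rw [h, LinearMap.id_apply]; nlinarith [mul_self_nonneg (φ v)]
  have h2 : sigPos Q ≤ sigPos Q' + 1 := sigPos_le_of_submodule _ _ φ.ker φ.ker.subtype
    (fun v => by rw [Submodule.subtype_apply, h, hz]; simp) 1 hk
  have h3 : sigNeg Q ≤ sigNeg Q' := sigPos_le_of_comp_le (-Q) (-Q') LinearMap.id fun v => by
    rw [neg_apply, neg_apply, LinearMap.id_apply, h]
    nlinarith [mul_self_nonneg (φ v)]
  have h4 : sigNeg Q' ≤ sigNeg Q + 1 := sigPos_le_of_submodule (-Q') (-Q) φ.ker φ.ker.subtype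
    (fun v => by
      rw [neg_apply, neg_apply, Submodule.subtype_apply, h, hz]; simp) 1 hk
  omega

end

noncomputable section

namespace GaussCode

variable (G : GaussCode)

/-! ### Checkerboard colourings and the Goeritz form -/

/-- Whether the region to the left of an edge is white, if `t x` tells whether the regions to the
left and to the right of the crossing `x` are white. -/
def edgeColour (t : G.Crossing → Bool) (e : G.Crossing × Bool) : Bool := xor e.2 (t e.1)

/-- Crossing another strand, an edge exchanges the colours of its two sides. -/
def IsColouring (t : G.Crossing → Bool) : Prop :=
  ∀ e, G.edgeColour t (G.succ e) = !G.edgeColour t e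

/-- `g` is constant along the boundary of the two white corners at `x`. -/
def WhiteAt (t : G.Crossing → Bool) (g : G.Crossing × Bool → ℝ) (x : G.Crossing) : Prop :=
  if t x then g (G.inLeft x) = g (G.outLeft x) ∧ g (G.inRight x) = g (G.outRight x)
  else g (G.inLeft x) = g (G.inRight x) ∧ g (G.outLeft x) = g (G.outRight x)

/-- The functions on the white regions, as functions on the edges. -/
def white (t : G.Crossing → Bool) : Submodule ℝ (G.Crossing × Bool → ℝ) where
  carrier := {g | ∀ x, G.WhiteAt t g x}
  add_mem' {a b} ha hb x := by
    have h1 := ha x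
    have h2 := hb x
    unfold WhiteAt at *
    split_ifs at * <;> simp [h1, h2]
  zero_mem' x := by simp [WhiteAt]
  smul_mem' c a ha x := by
    have h1 := ha x
    unfold WhiteAt at *
    split_ifs at * <;> simp [h1]

/-- The difference of the values at the two white corners of a crossing. -/
def drop (t : G.Crossing → Bool) : (G.Crossing × Bool → ℝ) →ₗ[ℝ] (G.Crossing → ℝ) where
  toFun g x := g (G.outLeft x) - if t x then g (G.outRight x) else g (G.inLeft x)
  map_add' a b := by
    ext x
    simp only [Pi.add_apply]
    split_ifs <;> ring
  map_smul' c a := by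
    ext x
    simp only [Pi.smul_apply, smul_eq_mul, RingHom.id_apply]
    split_ifs <;> ring

/-- The sign of a crossing, as a real number. -/
def realSign (x : G.Crossing) : ℝ := ((G.sign x : ℤ) : ℝ)

/-- The Goeritz index of a crossing. -/
def index (t : G.Crossing → Bool) (x : G.Crossing) : ℝ :=
  if t x then G.realSign x else -G.realSign x

/-- The Goeritz form on the functions on the white regions. -/
def goeritz (t : G.Crossing → Bool) : QuadraticForm ℝ (G.white t) :=
  (QuadraticMap.weightedSumSquares ℝ (G.index t)).comp ((G.drop t).domRestrict (G.white t))

/-- The Gordon–Litherland correction term. -/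
def correction (t : G.Crossing → Bool) : ℤ := ∑ x, if t x then (G.sign x : ℤ) else 0

variable {G} {t : G.Crossing → Bool}

theorem goeritz_apply (g : G.white t) :
    G.goeritz t g = ∑ x, G.index t x * (G.drop t g.1 x * G.drop t g.1 x) := by
  simp [goeritz, QuadraticMap.weightedSumSquares_apply]

theorem succ_inLeft (x : G.Crossing) : G.succ (G.inLeft x) = (x, true) := by simp [inLeft]

theorem succ_inRight (x : G.Crossing) : G.succ (G.inRight x) = (x, false) := by simp [inRight]

theorem edgeColour_outLeft (x : G.Crossing) : G.edgeColour t (G.outLeft x) = t x := by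
  simp [edgeColour, outLeft]

theorem edgeColour_outRight (x : G.Crossing) : G.edgeColour t (G.outRight x) = !t x := by
  simp [edgeColour, outRight]

theorem IsColouring.inLeft (ht : G.IsColouring t) (x : G.Crossing) :
    G.edgeColour t (G.inLeft x) = t x := by
  have := ht (G.inLeft x)
  rw [succ_inLeft] at this
  simpa [edgeColour] using this.symm

theorem IsColouring.inRight (ht : G.IsColouring t) (x : G.Crossing) :
    G.edgeColour t (G.inRight x) = !t x := by
  have := ht (G.inRight x)
  rw [succ_inRight] at this
  rw [← Bool.not_not (G.edgeColour t (G.inRight x)), ← this]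
  simp [edgeColour]

theorem IsColouring.not (ht : G.IsColouring t) : G.IsColouring fun x => !t x := fun e => by
  have := ht e
  simp only [edgeColour, Bool.xor_not] at *
  rw [this]

theorem mem_white {g : G.Crossing × Bool → ℝ} : g ∈ G.white t ↔ ∀ x, G.WhiteAt t g x := Iff.rfl

theorem whiteAt_true {x : G.Crossing} (hx : t x = true) {g : G.Crossing × Bool → ℝ} :
    G.WhiteAt t g x ↔ g (G.inLeft x) = g (G.outLeft x) ∧ g (G.inRight x) = g (G.outRight x) := by
  simp [WhiteAt, hx]

theorem whiteAt_false {x : G.Crossing} (hx : t x = false) {g : G.Crossing × Bool → ℝ} :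
    G.WhiteAt t g x ↔ g (G.inLeft x) = g (G.inRight x) ∧ g (G.outLeft x) = g (G.outRight x) := by
  simp [WhiteAt, hx]

theorem drop_true {x : G.Crossing} (hx : t x = true) (g : G.Crossing × Bool → ℝ) :
    G.drop t g x = g (G.outLeft x) - g (G.outRight x) := by
  simp [drop, hx]

theorem drop_false {x : G.Crossing} (hx : t x = false) (g : G.Crossing × Bool → ℝ) :
    G.drop t g x = g (G.outLeft x) - g (G.inLeft x) := by
  simp [drop, hx]

/-- Every edge leaves one crossing and arrives at one. -/
theorem sum_out_eq_sum_in (F : G.Crossing × Bool → ℝ) :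
    ∑ x, (F (G.outLeft x) + F (G.outRight x)) = ∑ x, (F (G.inLeft x) + F (G.inRight x)) := by
  have s1 : ∑ e, F e = ∑ x, (F (G.outLeft x) + F (G.outRight x)) := by
    rw [Fintype.sum_prod_type]
    refine Finset.sum_congr rfl fun x _ => ?_
    rw [Fintype.sum_bool, add_comm]; rfl
  have s2 : ∑ e, F (G.succ.symm e) = ∑ x, (F (G.inLeft x) + F (G.inRight x)) := by
    rw [Fintype.sum_prod_type]
    refine Finset.sum_congr rfl fun x _ => ?_
    rw [Fintype.sum_bool]; rfl
  rw [← s1, ← s2, Equiv.sum_comp]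

theorem realSign_eq (x : G.Crossing) :
    (G.sign x = 1 ∧ G.realSign x = 1) ∨ (G.sign x = -1 ∧ G.realSign x = -1) := by
  rcases Int.units_eq_one_or (G.sign x) with h | h <;> simp [realSign, h]

/-- The gradient of a function on the white regions is a circulation for functions on the black
regions. -/
theorem sum_drop_mul_drop (ht : G.IsColouring t) {f g : G.Crossing × Bool → ℝ}
    (hf : f ∈ G.white fun x => !t x) (hg : g ∈ G.white t) :
    ∑ x, (if t x then (1 : ℝ) else -1) * G.drop t g x * G.drop (fun x => !t x) f x = 0 := by
  let F : G.Crossing × Bool → ℝ := fun e => if G.edgeColour t e then f e * g e else -(f e * g e)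
  have h := sum_out_eq_sum_in F
  rw [← sub_eq_zero, ← Finset.sum_sub_distrib] at h
  rw [← h]
  refine Finset.sum_congr rfl fun x _ => ?_
  have h1 := hf x
  have h2 := hg x
  simp only [F, edgeColour_outLeft, edgeColour_outRight, ht.inLeft, ht.inRight]
  cases hx : t x
  · rw [whiteAt_true (by simp [hx])] at h1
    rw [whiteAt_false hx] at h2
    rw [drop_false hx, drop_true (by simp [hx])]
    simp [← h1.1, ← h1.2, ← h2.1, ← h2.2]
    ring
  · rw [whiteAt_false (by simp [hx])] at h1
    rw [whiteAt_true hx] at h2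
    rw [drop_true hx, drop_false (by simp [hx])]
    simp [← h1.1, ← h1.2, ← h2.1, ← h2.2]
    ring

end GaussCode

namespace LinkDiagram

open GaussCode

variable (D : LinkDiagram)

/-- The constant flow `1` is conserved at every crossing, so planarity gives it a potential on the
regions: an Alexander numbering. Its parity is a checkerboard colouring. -/
theorem exists_colouring : ∃ t, D.IsColouring t := by
  have h1 : (fun _ => 1 : D.Crossing × Bool → ℝ) ∈ LinearMap.range D.jump := by
    rw [D.range_jump, LinearMap.mem_ker]
    ext x
    simp [inflow]
  obtain ⟨h, hh⟩ := h1
  have hj : ∀ e, h (D.side e true) = h (D.side e false) + 1 := fun e => by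
    have := congrFun hh e
    simp only [jump, LinearMap.coe_mk, AddHom.coe_mk] at this
    linarith
  -- The potential is only real-valued, but it jumps by exactly one across an edge, so the parity of
  -- its floor alternates.
  let p : D.Crossing × Bool → Bool := fun e => decide (Even ⌊h (D.side e true)⌋)
  have hp : ∀ x, p (D.inRight x) = !p (D.inLeft x) ∧ p (D.outLeft x) = p (D.inLeft x) ∧
      p (D.outRight x) = !p (D.inLeft x) := fun x => by
    have e1 := hj (D.inLeft x)
    have e2 := hj (D.outLeft x)
    rw [D.side_north] at e2
    rw [← D.side_south] at e1
    have e3 := D.side_west x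
    simp only [p]
    rw [e3] at e1 ⊢
    have e4 : h (D.side (D.inRight x) true) = h (D.side (D.outRight x) true) := by linarith
    rw [e2, e4, Int.floor_add_one]
    refine ⟨?_, ?_, ?_⟩ <;> simp [← Int.not_even_iff_odd]
  refine ⟨fun x => p (D.outLeft x), ?_⟩
  have hout : ∀ e, D.edgeColour (fun x => p (D.outLeft x)) e = p e := by
    rintro ⟨x, b⟩
    cases b
    · simp [edgeColour, outLeft]
    · have := hp x
      simp only [edgeColour, Bool.true_xor]
      rw [this.2.1, ← this.2.2]
      rfl
  intro e
  rw [hout e]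
  rcases D.eq_in e with he | he <;> rw [he]
  · rw [succ_inLeft, hout]
    exact (hp _).2.2
  · rw [succ_inRight, hout, (hp _).1, Bool.not_not]
    exact (hp _).2.1

end LinkDiagram

end

/-! ### Cycles as pairs of black and white functions, and exactness -/

noncomputable section

namespace LinkDiagram

open GaussCode Module

variable (D : LinkDiagram)

/-- The Euler characteristic turns the two upper bounds on kernels behind `range_jump` into
equalities. -/
theorem finrank_ker_inflow :
    finrank ℝ (LinearMap.ker D.inflow) = Nat.card D.Crossing + Nat.card D.Piece := by
  classical
  have := Fintype.ofFinite D.Face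
  have h0 := D.range_jump
  have h1 := LinearMap.finrank_range_add_finrank_ker D.jump
  have h2 := LinearMap.finrank_range_add_finrank_ker D.inflow
  have h3 := LinearMap.finrank_range_add_finrank_ker D.inflow.dualMap
  have h4 := LinearMap.finrank_range_dualMap_eq_finrank_range D.inflow
  have h5 := D.finrank_ker_jump_le
  have h6 := D.finrank_ker_dual_inflow_le
  have h7 := D.planar
  rw [Module.finrank_fintype_fun_eq_card, ← Nat.card_eq_fintype_card, h0] at h1
  rw [Module.finrank_fintype_fun_eq_card, ← Nat.card_eq_fintype_card, Nat.card_prod,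
    Nat.card_eq_fintype_card (α := Bool), Fintype.card_bool] at h2
  rw [Subspace.dual_finrank_eq, Module.finrank_fintype_fun_eq_card,
    ← Nat.card_eq_fintype_card] at h3
  omega

/-- A cycle is determined by its flow along the edges. -/
def cyclesEquiv : D.cycles ≃ₗ[ℝ] LinearMap.ker D.inflow where
  toFun z := ⟨z.1.1, by
    rw [LinearMap.mem_ker]
    ext x
    have := z.2 x
    simp only [inflow, LinearMap.coe_mk, AddHom.coe_mk, Pi.zero_apply]
    linarith [this.1, this.2]⟩
  invFun z := ⟨(z.1, fun x => z.1 (D.inLeft x) - z.1 (D.outLeft x)), fun x => by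
    have := congrFun (LinearMap.mem_ker.1 z.2) x
    simp only [inflow, LinearMap.coe_mk, AddHom.coe_mk, Pi.zero_apply] at this
    simp only
    constructor <;> linarith⟩
  map_add' _ _ := rfl
  map_smul' _ _ := rfl
  left_inv z := by
    apply Subtype.ext
    refine Prod.ext rfl (funext fun x => ?_)
    have := z.2 x
    simp only
    linarith [this.1]
  right_inv _ := rfl

/-- The functions on the edges that are constant on each piece of the diagram. -/
def pieceConstant : Submodule ℝ (D.Crossing × Bool → ℝ) :=
  LinearMap.range (LinearMap.funLeft ℝ ℝ fun e : D.Crossing × Bool => (Quot.mk _ e.1 : D.Piece))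

theorem finrank_pieceConstant : finrank ℝ D.pieceConstant = Nat.card D.Piece := by
  have := Fintype.ofFinite D.Piece
  rw [pieceConstant, LinearMap.finrank_range_of_inj]
  · rw [Nat.card_eq_fintype_card (α := D.Piece)]
    exact Module.finrank_fintype_fun_eq_card (η := D.Piece) ℝ
  apply LinearMap.funLeft_injective_of_surjective
  intro q
  induction q using Quot.ind with
  | _ x => exact ⟨(x, true), rfl⟩

theorem mem_pieceConstant {g : D.Crossing × Bool → ℝ} :
    g ∈ D.pieceConstant ↔ ∀ x, g (D.inLeft x) = g (D.outLeft x) ∧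
      g (D.inRight x) = g (D.outLeft x) ∧ g (D.outRight x) = g (D.outLeft x) := by
  constructor
  · rintro ⟨p, rfl⟩ x
    have h1 : ∀ s, (Quot.mk _ (D.succ.symm (x, s)).1 : D.Piece) = Quot.mk _ x := fun s =>
      Quot.sound ⟨(D.succ.symm (x, s)).2, by simp⟩
    simp only [LinearMap.funLeft_apply, inLeft, inRight, outLeft, outRight, h1, and_self]
  · intro h
    have hx : ∀ e : D.Crossing × Bool, g e = g (D.outLeft e.1) := by
      rintro ⟨x, b⟩
      cases b
      · rfl
      · exact (h x).2.2
    refine ⟨Quot.lift (fun x => g (D.outLeft x)) ?_, ?_⟩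
    · rintro a b ⟨s, rfl⟩
      show g _ = g _
      rw [← hx (a, s)]
      rcases D.eq_in (a, s) with he | he
      · conv_lhs => rw [he]
        exact (h _).1
      · conv_lhs => rw [he]
        exact (h _).2.1
    · ext e
      exact (hx e).symm

variable {D} {t : D.Crossing → Bool}

/-- Equal values along each white corner and equal values at the two white corners together say that
all four edges at the crossing carry the same value. -/
theorem white_inf_ker_drop :
    D.white t ⊓ LinearMap.ker (D.drop t) = D.pieceConstant := by
  ext g
  rw [mem_pieceConstant, Submodule.mem_inf, mem_white, LinearMap.mem_ker, funext_iff,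
    ← forall_and]
  refine forall_congr' fun x => ?_
  cases hx : t x
  · rw [whiteAt_false hx, drop_false hx, Pi.zero_apply, sub_eq_zero]
    constructor
    · rintro ⟨⟨h1, h2⟩, h3⟩
      exact ⟨h3.symm, h1.symm.trans h3.symm, h2.symm⟩
    · rintro ⟨h1, h2, h3⟩
      exact ⟨⟨h1.trans h2.symm, h3.symm⟩, h1.symm⟩
  · rw [whiteAt_true hx, drop_true hx, Pi.zero_apply, sub_eq_zero]
    constructor
    · rintro ⟨⟨h1, h2⟩, h3⟩
      exact ⟨h1, h2.trans h3.symm, h3.symm⟩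
    · rintro ⟨h1, h2, h3⟩
      exact ⟨⟨h1, h2.trans h3.symm⟩, h3.symm⟩

variable (t) in
/-- The cycle whose coefficient on an edge is the difference between the values on its left and on
its right of a function on the regions, given by a function on the black regions and a function on
the white regions. -/
def flow : (D.white fun x => !t x) × D.white t →ₗ[ℝ] (D.Crossing × Bool → ℝ) where
  toFun p e := if D.edgeColour t e then p.2.1 e - p.1.1 e else p.1.1 e - p.2.1 e
  map_add' a b := by
    ext e
    simp only [Prod.snd_add, Prod.fst_add, Submodule.coe_add, Pi.add_apply]
    split_ifs <;> ring
  map_smul' c a := by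
    ext e
    simp only [Prod.smul_snd, Prod.smul_fst, Submodule.coe_smul, Pi.smul_apply, smul_eq_mul,
      RingHom.id_apply]
    split_ifs <;> ring

/-- By `range_jump` every conserved flow is the jump of a function on the regions; such a function
splits into its black and its white part, each recorded on the edges bordering the region. -/
theorem range_flow (ht : D.IsColouring t) :
    LinearMap.range (flow t) = LinearMap.ker D.inflow := by
  apply le_antisymm
  · rintro _ ⟨⟨⟨f, hf⟩, ⟨g, hg⟩⟩, rfl⟩
    rw [LinearMap.mem_ker]
    ext x
    have h1 := hf x
    have h2 := hg x
    simp only [inflow, flow, LinearMap.coe_mk, AddHom.coe_mk, Pi.zero_apply, edgeColour_outLeft,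
      edgeColour_outRight, ht.inLeft, ht.inRight]
    cases hx : t x
    · rw [whiteAt_true (by simp [hx])] at h1
      rw [whiteAt_false hx] at h2
      simp [h1.1, h1.2, h2.1, h2.2]
    · rw [whiteAt_false (by simp [hx])] at h1
      rw [whiteAt_true hx] at h2
      simp [h1.1, h1.2, h2.1, h2.2]
  · rw [← D.range_jump]
    rintro _ ⟨h, rfl⟩
    have hg : ∀ s : Bool, (fun e => h (D.side e (xor s (D.edgeColour t e)))) ∈
        D.white fun x => xor s (t x) := by
      intro s x
      have w := D.side_west x
      have e := D.side_east x
      have so := D.side_south x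
      have no := D.side_north x
      simp only [WhiteAt, edgeColour_outLeft, edgeColour_outRight, ht.inLeft, ht.inRight]
      cases s <;> cases hx : t x <;> simp [w, e, so, no]
    refine ⟨(⟨_, by simpa using hg true⟩, ⟨_, by simpa using hg false⟩), ?_⟩
    ext e
    simp only [flow, jump, LinearMap.coe_mk, AddHom.coe_mk]
    cases hx : D.edgeColour t e <;> simp

/-- In the kernel the black and the white function agree on every edge, so the common function is
constant along all four corners of each crossing. -/
theorem finrank_ker_flow :
    finrank ℝ (LinearMap.ker (flow t)) = Nat.card D.Piece := by
  have hnot : (D.white fun x => !t x) ⊓ D.white t = D.pieceConstant := by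
    ext g
    rw [mem_pieceConstant, Submodule.mem_inf, mem_white, mem_white, ← forall_and]
    refine forall_congr' fun x => ?_
    cases hx : t x
    · rw [whiteAt_true (by simp [hx]), whiteAt_false hx]
      grind
    · rw [whiteAt_false (by simp [hx]), whiteAt_true hx]
      grind
  rw [← finrank_pieceConstant]
  have hmem : ∀ p : LinearMap.ker (flow t), p.1.1.1 = p.1.2.1 := by
    rintro ⟨p, hp⟩
    ext e
    have := congrFun (LinearMap.mem_ker.1 hp) e
    simp only [flow, LinearMap.coe_mk, AddHom.coe_mk, Pi.zero_apply] at this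
    split_ifs at this <;> simp only <;> linarith
  rw [← hnot]
  refine LinearEquiv.finrank_eq
    { toFun := fun p => ⟨p.1.2.1, by
        refine ⟨?_, p.1.2.2⟩
        rw [← hmem]
        exact p.1.1.2⟩
      invFun := fun g => ⟨(⟨g.1, g.2.1⟩, ⟨g.1, g.2.2⟩), by
        rw [LinearMap.mem_ker]
        ext e
        simp [flow]⟩
      map_add' := fun _ _ => rfl
      map_smul' := fun _ _ => rfl
      left_inv := fun p => by
        apply Subtype.ext
        exact Prod.ext (Subtype.ext (hmem p).symm) rfl
      right_inv := fun _ => rfl }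

/-- Euler's formula: the black and the white regions together are all the regions. -/
theorem finrank_white_add (ht : D.IsColouring t) :
    finrank ℝ (D.white fun x => !t x) + finrank ℝ (D.white t) =
      Nat.card D.Crossing + 2 * Nat.card D.Piece := by
  have h := LinearMap.finrank_range_add_finrank_ker (flow t)
  rw [range_flow ht, finrank_ker_inflow, finrank_ker_flow, finrank_prod] at h
  omega

theorem finrank_range_drop :
    finrank ℝ (LinearMap.range ((D.drop t).domRestrict (D.white t))) + Nat.card D.Piece =
      finrank ℝ (D.white t) := by
  rw [← LinearMap.finrank_range_add_finrank_ker ((D.drop t).domRestrict (D.white t)),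
    ← finrank_pieceConstant, ← white_inf_ker_drop (t := t), LinearMap.ker_domRestrict,
    ← (Submodule.comapSubtypeEquivOfLe (inf_le_left (a := D.white t)
      (b := LinearMap.ker (D.drop t)))).finrank_eq, Submodule.comap_inf,
    Submodule.comap_subtype_self, top_inf_eq]

/-- Exactness: a circulation for functions on the black regions is the gradient of a function on the
white regions. -/
theorem exists_drop_eq (ht : D.IsColouring t) (y : D.Crossing → ℝ)
    (hy : ∀ f ∈ D.white fun x => !t x, ∑ x, y x * D.drop (fun x => !t x) f x = 0) :
    ∃ k ∈ D.white t, ∀ x, D.drop t k x = (if t x then (1 : ℝ) else -1) * y x := by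
  let s : D.Crossing → ℝ := fun x => if t x then 1 else -1
  have hs : ∀ x, s x * s x = 1 := fun x => by simp only [s]; split_ifs <;> norm_num
  let S : (D.Crossing → ℝ) ≃ₗ[ℝ] (D.Crossing → ℝ) :=
    { toFun := fun y x => s x * y x
      invFun := fun y x => s x * y x
      map_add' := fun a b => by ext x; simp [mul_add]
      map_smul' := fun c a => by ext x; simp [mul_left_comm]
      left_inv := fun a => by ext x; simp [← mul_assoc, hs]
      right_inv := fun a => by ext x; simp [← mul_assoc, hs] }
  let A := (LinearMap.range ((D.drop t).domRestrict (D.white t))).map (S : _ →ₗ[ℝ] D.Crossing → ℝ)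
  let L := (D.drop fun x => !t x).domRestrict (D.white fun x => !t x)
  let M : (D.Crossing → ℝ) →ₗ[ℝ] Module.Dual ℝ (D.white fun x => !t x) :=
    L.dualMap ∘ₗ (dotProductEquiv ℝ D.Crossing : _ →ₗ[ℝ] _)
  have hM : ∀ y f, M y f = ∑ x, y x * D.drop (fun x => !t x) f.1 x := fun y f => by
    simp [M, L, dotProduct]
  have hA : A ≤ LinearMap.ker M := by
    rintro _ ⟨_, ⟨⟨g, hg⟩, rfl⟩, rfl⟩
    rw [LinearMap.mem_ker]
    ext f
    rw [hM]
    exact sum_drop_mul_drop ht f.2 hg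
  -- One inclusion is the discrete Stokes formula. For equality, the two gradient spaces have the
  -- dimensions of the two function spaces less one per piece, and by Euler's formula these add up
  -- to the number of crossings.
  have hd : finrank ℝ (LinearMap.ker M) ≤ finrank ℝ A := by
    have h1 := LinearMap.finrank_range_add_finrank_ker M
    have h2 : finrank ℝ (LinearMap.range M) = finrank ℝ (LinearMap.range L) := by
      rw [← LinearMap.finrank_range_dualMap_eq_finrank_range L, LinearMap.range_comp_of_range_eq_top]
      exact LinearEquiv.range _
    have h3 : finrank ℝ A =
        finrank ℝ (LinearMap.range ((D.drop t).domRestrict (D.white t))) := S.finrank_map_eq _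
    have h4 := finrank_range_drop (D := D) (t := t)
    have h5 : finrank ℝ (LinearMap.range L) + _ = _ := finrank_range_drop
    have h6 := finrank_white_add ht
    rw [Module.finrank_fintype_fun_eq_card, ← Nat.card_eq_fintype_card] at h1
    omega
  have hmem : y ∈ LinearMap.ker M := by
    rw [LinearMap.mem_ker]
    ext f
    rw [hM]
    exact hy f.1 f.2
  rw [← Submodule.eq_of_le_of_finrank_le hA hd] at hmem
  obtain ⟨_, ⟨⟨k, hk⟩, rfl⟩, rfl⟩ := hmem
  refine ⟨k, hk, fun x => ?_⟩
  show _ = s x * (s x * D.drop t k x)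
  rw [← mul_assoc, hs, one_mul]

end LinkDiagram

end

/-! ### The linking form as a pullback of the Goeritz form plus a diagonal form -/

noncomputable section

namespace LinkDiagram

open GaussCode Module

variable {D : LinkDiagram} {t : D.Crossing → Bool}

/-- The cycle associated with a pair of functions on the black and on the white regions. -/
def cycleOf (ht : D.IsColouring t) : (D.white fun x => !t x) × D.white t →ₗ[ℝ] D.cycles :=
  (D.cyclesEquiv.symm : _ →ₗ[ℝ] D.cycles) ∘ₗ
    (flow t).codRestrict (LinearMap.ker D.inflow) fun p => by
      rw [← range_flow ht]; exact ⟨p, rfl⟩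

theorem cycleOf_fst (ht : D.IsColouring t) (p) : (cycleOf ht p).1.1 = flow t p := rfl

theorem cycleOf_snd (ht : D.IsColouring t) (p) (x) : (cycleOf ht p).1.2 x =
    flow t p (D.inLeft x) - flow t p (D.outLeft x) := rfl

theorem cycleOf_surjective (ht : D.IsColouring t) : Function.Surjective (cycleOf ht) := by
  intro z
  have h : (D.cyclesEquiv z).1 ∈ LinearMap.range (flow t) := by
    rw [range_flow ht]; exact (D.cyclesEquiv z).2
  obtain ⟨p, hp⟩ := h
  refine ⟨p, D.cyclesEquiv.injective (Subtype.ext ?_)⟩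
  rw [← hp]
  rfl

/-- The cycle passes through the band at `x` according to the difference of the values to the north
and to the south. -/
theorem cycleOf_snd_eq (ht : D.IsColouring t) (p) (x) : (cycleOf ht p).1.2 x =
    if t x then D.drop (fun x => !t x) p.1.1 x else D.drop t p.2.1 x := by
  obtain ⟨⟨f, hf⟩, ⟨g, hg⟩⟩ := p
  have h1 := hf x
  have h2 := hg x
  simp only [cycleOf_snd, flow, LinearMap.coe_mk, AddHom.coe_mk, edgeColour_outLeft, ht.inLeft]
  cases hx : t x
  · rw [whiteAt_true (by simp [hx])] at h1
    rw [whiteAt_false hx] at h2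
    simp only [drop_false hx, h1.1]
    simp
  · rw [whiteAt_false (by simp [hx])] at h1
    rw [whiteAt_true hx] at h2
    rw [drop_false (by simp [hx]), h2.1]
    simp

/-- A cycle avoiding all bands is constant along each Seifert circle, hence a combination of these
circles. -/
theorem mem_boundaries (z : D.cycles) : z ∈ D.boundaries ↔ z.1.2 = 0 := by
  classical
  constructor
  · intro hz
    have : D.boundaries ≤ LinearMap.ker ((LinearMap.snd ℝ _ _).comp D.cycles.subtype) := by
      rw [boundaries, Submodule.span_le]
      rintro _ ⟨C, rfl⟩
      rfl
    exact this hz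
  · intro hz
    have : Finite D.SeifertCircle := Quot.finite _
    have := Fintype.ofFinite D.SeifertCircle
    have hstep : ∀ e, z.1.1 e = z.1.1 (D.seifertStep e) := fun e => by
      have h0 : ∀ x, z.1.2 x = 0 := fun x => congrFun hz x
      have hin := D.eq_in e
      generalize (D.succ e).1 = x at hin
      rcases hin with rfl | rfl
      · rw [seifertStep_inLeft, (z.2 x).1, h0, add_zero]
      · rw [seifertStep_inRight, ← (z.2 x).2, h0, add_zero]
    let c : D.SeifertCircle → ℝ := Quot.lift z.1.1 (by rintro a b rfl; exact hstep a)
    have hz' : z = ∑ C, c C • D.circleCycle C := by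
      apply Subtype.ext
      refine Prod.ext ?_ ?_
      · ext e
        simp only [AddSubmonoidClass.coe_finsetSum, Submodule.coe_smul, Prod.fst_sum,
          Finset.sum_apply, Prod.smul_fst, Pi.smul_apply, smul_eq_mul, circleCycle,
          mul_ite, mul_one, mul_zero]
        exact ((Finset.sum_ite_eq (Finset.univ : Finset D.SeifertCircle) (Quot.mk _ e) c).trans
          (if_pos (Finset.mem_univ (α := D.SeifertCircle) _))).symm
      · rw [hz]
        simp only [AddSubmonoidClass.coe_finsetSum, Submodule.coe_smul, Prod.snd_sum,
          Prod.smul_snd, circleCycle]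
        simp
    rw [hz']
    exact Submodule.sum_mem _ fun C _ => Submodule.smul_mem _ _ (Submodule.subset_span ⟨C, rfl⟩)

variable (t) in
/-- The map along which the symmetrised linking form is the pullback of the sum of the Goeritz form
and a diagonal form. -/
def splitting : (D.white fun x => !t x) × D.white t →ₗ[ℝ] D.white t × ({x // t x} → ℝ) :=
  LinearMap.prod (LinearMap.snd ℝ _ _)
    { toFun := fun p x => D.drop (fun x => !t x) p.1.1 x - D.realSign x * D.drop t p.2.1 x
      map_add' := fun a b => by ext x; simp; ring
      map_smul' := fun c a => by ext x; simp; ring }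

variable (D t) in
/-- The diagonal form contributing the correction term. -/
def diagonalForm : QuadraticForm ℝ ({x // t x} → ℝ) :=
  QuadraticMap.weightedSumSquares ℝ fun x => -D.realSign x.1

/-- At a crossing with white left and right sides the band carries the black drop `b`, and with
white drop `w` and sign `ε` one has `ε w² - ε (b - ε w)² = 2 b w - ε b²`. At the other crossings the
band carries the white drop. Up to terms telescoping along the edges, this is twice the local
contribution to the linking number. -/
theorem linkPush_cycleOf (ht : D.IsColouring t) (p) :
    2 * D.linkPush (cycleOf ht p).1 (cycleOf ht p).1 =
      QuadraticMap.prod (D.goeritz t) (diagonalForm D t) (splitting t p) := by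
  obtain ⟨⟨f, hf⟩, ⟨g, hg⟩⟩ := p
  -- The two sides differ at each crossing by the outgoing minus the incoming values of `F`.
  let F : D.Crossing × Bool → ℝ := fun e =>
    if D.edgeColour t e then -(g e * g e) else 2 * (f e * g e) - f e * f e
  have h := sum_out_eq_sum_in F
  rw [← sub_eq_zero, ← Finset.sum_sub_distrib] at h
  have hdiag : ∀ y : D.Crossing → ℝ, diagonalForm D t (fun x => y x.1) =
      ∑ x, if t x then -D.realSign x * (y x * y x) else 0 := fun y => by
    rw [diagonalForm, QuadraticMap.weightedSumSquares_apply, ← Finset.sum_filter,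
      ← Finset.sum_subtype_eq_sum_filter]
    simp [Finset.subtype_univ]
  have hprod : QuadraticMap.prod (D.goeritz t) (diagonalForm D t)
      (splitting t (⟨f, hf⟩, ⟨g, hg⟩)) = _ + _ :=
    congrArg₂ (· + ·) (goeritz_apply (G := D.toGaussCode) (t := t) ⟨g, hg⟩)
      (hdiag fun x => D.drop (fun x => !t x) f x - D.realSign x * D.drop t g x)
  rw [hprod, ← Finset.sum_add_distrib, ← sub_eq_zero, linkPush, LinearMap.mk₂_apply,
    Finset.mul_sum, ← Finset.sum_sub_distrib]
  refine Eq.trans (Finset.sum_congr rfl fun x _ => ?_) h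
  have h1 := hf x
  have h2 := hg x
  rw [cycleOf_fst, cycleOf_snd_eq]
  simp only [F, flow, LinearMap.coe_mk, AddHom.coe_mk, edgeColour_outLeft, edgeColour_outRight,
    ht.inLeft, ht.inRight, GaussCode.index]
  cases hx : t x
  · rw [whiteAt_true (by simp [hx])] at h1
    rw [whiteAt_false hx] at h2
    rw [drop_false hx]
    rcases realSign_eq (G := D.toGaussCode) x with ⟨e1, e2⟩ | ⟨e1, e2⟩ <;>
    · simp [e1, e2, ← h1.1, ← h2.1, ← h2.2]
      ring
  · rw [whiteAt_false (by simp [hx])] at h1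
    rw [whiteAt_true hx] at h2
    rw [drop_true hx, drop_false (by simp [hx])]
    rcases realSign_eq (G := D.toGaussCode) x with ⟨e1, e2⟩ | ⟨e1, e2⟩ <;>
    · simp [e1, e2, ← h1.1, ← h1.2, ← h2.1, ← h2.2]
      ring

/-- Both forms are pullbacks, along surjections, of the symmetrised pairing on the homology of discs
and bands. -/
theorem symmetrisedPairing_self (ht : D.IsColouring t) :
    (sigPos D.symmetrisedPairing.toQuadraticMap = sigPos
      ((QuadraticMap.prod (D.goeritz t) (diagonalForm D t)).comp (splitting t))) ∧
    (sigNeg D.symmetrisedPairing.toQuadraticMap = sigNeg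
      ((QuadraticMap.prod (D.goeritz t) (diagonalForm D t)).comp (splitting t))) := by
  let S := (D.discBandPairing.flip + D.discBandPairing).toQuadraticMap
  have h1 : D.symmetrisedPairing.toQuadraticMap = S.comp (LinearMap.fst ℝ _ _) := by
    ext v
    rfl
  have h2 : (QuadraticMap.prod (D.goeritz t) (diagonalForm D t)).comp (splitting t) =
      S.comp (D.boundaries.mkQ ∘ₗ cycleOf ht) := by
    ext p
    rw [QuadraticMap.comp_apply, ← linkPush_cycleOf ht, two_mul]
    rfl
  have hs : Function.Surjective (D.boundaries.mkQ ∘ₗ cycleOf ht) := by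
    rw [LinearMap.coe_comp]
    exact (Submodule.mkQ_surjective _).comp (cycleOf_surjective ht)
  rw [h1, h2, sigPos_comp_of_surjective _ _ hs, sigNeg_comp_of_surjective _ _ hs,
    sigPos_comp_of_surjective _ _ Prod.fst_surjective,
    sigNeg_comp_of_surjective _ _ Prod.fst_surjective]
  exact ⟨rfl, rfl⟩

end LinkDiagram

end

/-! ### Coisotropy, dimension counts and the Gordon–Litherland formula -/

noncomputable section

namespace LinkDiagram

open GaussCode Module

variable {D : LinkDiagram} {t : D.Crossing → Bool}

theorem polar_goeritz (g k : D.white t) : QuadraticMap.polar (D.goeritz t) g k =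
    2 * ∑ x, D.index t x * (D.drop t g.1 x * D.drop t k.1 x) := by
  rw [QuadraticMap.polar, goeritz_apply, goeritz_apply, goeritz_apply, Finset.mul_sum,
    ← Finset.sum_sub_distrib, ← Finset.sum_sub_distrib]
  refine Finset.sum_congr rfl fun x _ => ?_
  rw [Submodule.coe_add, map_add, Pi.add_apply]
  ring

theorem polar_diagonalForm (y z : {x // t x} → ℝ) : QuadraticMap.polar (diagonalForm D t) y z =
    -2 * ∑ x, D.realSign x.1 * (y x * z x) := by
  rw [QuadraticMap.polar, diagonalForm, QuadraticMap.weightedSumSquares_apply,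
    QuadraticMap.weightedSumSquares_apply, QuadraticMap.weightedSumSquares_apply, Finset.mul_sum,
    ← Finset.sum_sub_distrib, ← Finset.sum_sub_distrib]
  refine Finset.sum_congr rfl fun x _ => ?_
  simp only [Pi.add_apply, smul_eq_mul]
  ring

theorem sum_subtype_colour (y : D.Crossing → ℝ) :
    ∑ x : {x // t x}, y x.1 = ∑ x, if t x then y x else 0 := by
  rw [← Finset.sum_filter, ← Finset.sum_subtype_eq_sum_filter]
  simp [Finset.subtype_univ]

theorem realSign_mul_self (x : D.Crossing) : D.realSign x * D.realSign x = 1 := by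
  rcases realSign_eq (G := D.toGaussCode) x with h | h <;> simp [h.2]

/-- Exactness is used twice. Orthogonality to the images of black functions makes the signed
diagonal component of `w` the gradient of a white function `k`; orthogonality to the images of white
functions then makes the weighted gradient of `g₀ + k` that of a black function `f`. The pair `(-f,
g₀)` is a preimage of `w`. -/
theorem splitting_coisotropic (ht : D.IsColouring t) (w : D.white t × ({x // t x} → ℝ))
    (hw : ∀ p, QuadraticMap.polar (QuadraticMap.prod (D.goeritz t) (diagonalForm D t)) w
      (splitting t p) = 0) : w ∈ LinearMap.range (splitting t) := by
  obtain ⟨g₀, y₀⟩ := w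
  let y : D.Crossing → ℝ := fun x => if h : t x then y₀ ⟨x, h⟩ else 0
  have hy : ∀ x : {x // t x}, y₀ x = y x.1 := fun x => by simp [y, x.2]
  have hy0 : ∀ x, t x = false → y x = 0 := fun x h => by simp [y, h]
  have hw' : ∀ f ∈ D.white fun x => !t x, ∀ g ∈ D.white t,
      ∑ x, D.index t x * (D.drop t g₀.1 x * D.drop t g x) - ∑ x, D.realSign x *
        (y x * (D.drop (fun x => !t x) f x - D.realSign x * D.drop t g x)) = 0 := by
    intro f hf g hg
    have h := hw (⟨f, hf⟩, ⟨g, hg⟩)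
    rw [QuadraticMap.polar_prod] at h
    change QuadraticMap.polar (D.goeritz t) g₀ ⟨g, hg⟩ + QuadraticMap.polar (diagonalForm D t) y₀
      (fun x => D.drop (fun x => !t x) f x - D.realSign x * D.drop t g x) = 0 at h
    rw [polar_goeritz, polar_diagonalForm] at h
    simp only [hy] at h
    rw [sum_subtype_colour (fun x => D.realSign x *
        (y x * (D.drop (fun x => !t x) f x - D.realSign x * D.drop t g x)))] at h
    have h2 : ∀ x, (if t x then D.realSign x *
        (y x * (D.drop (fun x => !t x) f x - D.realSign x * D.drop t g x)) else 0) =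
        D.realSign x * (y x * (D.drop (fun x => !t x) f x - D.realSign x * D.drop t g x)) := by
      intro x
      split_ifs with hx
      · rfl
      · simp [hy0 x (by simpa using hx)]
    simp only [h2] at h
    linarith
  obtain ⟨k, hk, hky⟩ := exists_drop_eq ht (fun x => D.realSign x * y x) fun f hf => by
    have := hw' f hf 0 (Submodule.zero_mem _)
    simp only [map_zero, Pi.zero_apply, mul_zero, Finset.sum_const_zero, sub_zero, zero_sub,
      neg_eq_zero] at this
    rw [← this]
    refine Finset.sum_congr rfl fun x _ => ?_
    ring
  have hr : ∀ g ∈ D.white t, ∑ x, D.index t x * D.drop t (g₀.1 + k) x * D.drop t g x = 0 := by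
    intro g hg
    have := hw' 0 (Submodule.zero_mem _) g hg
    rw [← Finset.sum_sub_distrib] at this
    rw [← this]
    refine Finset.sum_congr rfl fun x _ => ?_
    rw [map_add, Pi.add_apply, hky x]
    cases hx : t x
    · simp [GaussCode.index, hx, hy0 x hx]
      ring
    · simp [GaussCode.index, hx]
      ring
  -- The opposite colouring exchanges the roles of black and white.
  obtain ⟨f, hf, hfy⟩ := exists_drop_eq ht.not
    (fun x => D.index t x * D.drop t (g₀.1 + k) x) (by simpa using hr)
  refine ⟨(⟨-f, Submodule.neg_mem _ hf⟩, g₀), Prod.ext rfl (funext fun x => ?_)⟩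
  show D.drop (fun x => !t x) (-f) x.1 - D.realSign x * D.drop t g₀.1 x = y₀ x
  rw [hy, map_neg, Pi.neg_apply, hfy, map_add, Pi.add_apply, hky]
  have e1 := realSign_mul_self x.1
  simp [GaussCode.index, x.2]
  linear_combination y x.1 * e1

variable (t) in
/-- The differences of a function on the black regions at the crossings with two white sides. -/
def blackDrop : (D.white fun x => !t x) →ₗ[ℝ] ({x // t x} → ℝ) :=
  LinearMap.funLeft ℝ ℝ Subtype.val ∘ₗ (D.drop fun x => !t x).domRestrict _

variable (t) in
/-- The differences of a function on the white regions at the crossings satisfying `s`. -/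
def whiteDrop (s : D.Crossing → Prop) : D.white t →ₗ[ℝ] ({x // s x} → ℝ) :=
  LinearMap.funLeft ℝ ℝ Subtype.val ∘ₗ (D.drop t).domRestrict _

/-- If the white component vanishes, the diagonal component reduces to the black drops, so only
`blackDrop` contributes to the kernel. -/
theorem finrank_range_splitting :
    finrank ℝ (LinearMap.range (splitting t)) + finrank ℝ (LinearMap.ker (blackDrop t)) =
      finrank ℝ (D.white fun x => !t x) + finrank ℝ (D.white t) := by
  rw [← finrank_prod (R := ℝ) (M := D.white fun x => !t x) (M' := D.white t),
    ← LinearMap.finrank_range_add_finrank_ker (splitting t)]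
  congr 1
  have h : LinearMap.ker (splitting t) = (LinearMap.ker (blackDrop t)).prod ⊥ := by
    ext ⟨f, g⟩
    rw [LinearMap.mem_ker, Submodule.mem_prod, LinearMap.mem_ker, Submodule.mem_bot]
    constructor
    · intro h
      obtain rfl : g = 0 := congrArg Prod.fst h
      refine ⟨?_, rfl⟩
      ext x
      have := congrFun (congrArg Prod.snd h) x
      simpa [splitting, blackDrop] using this
    · rintro ⟨h, rfl⟩
      refine Prod.ext rfl (funext fun x => ?_)
      have := congrFun h x
      simpa [splitting, blackDrop] using this
  rw [h, finrank_submodule_prod, finrank_bot, add_zero]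

/-- A pair of functions gives a trivial class exactly when no band is used. Which of the two drops
measures the flow in a band depends on the colour, so the kernel is a product. -/
theorem finrank_discBandHomology (ht : D.IsColouring t) :
    finrank ℝ D.DiscBandHomology + (finrank ℝ (LinearMap.ker (blackDrop t)) +
      finrank ℝ (LinearMap.ker (whiteDrop t fun x => t x = false))) =
      finrank ℝ (D.white fun x => !t x) + finrank ℝ (D.white t) := by
  have hs : Function.Surjective (D.boundaries.mkQ ∘ₗ cycleOf ht) := by
    rw [LinearMap.coe_comp]
    exact (Submodule.mkQ_surjective _).comp (cycleOf_surjective ht)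
  rw [← finrank_prod (R := ℝ) (M := D.white fun x => !t x) (M' := D.white t),
    ← LinearMap.finrank_range_add_finrank_ker (D.boundaries.mkQ ∘ₗ cycleOf ht),
    LinearMap.range_eq_top.2 hs, finrank_top, ← finrank_submodule_prod]
  suffices h : LinearMap.ker (D.boundaries.mkQ ∘ₗ cycleOf ht) = (LinearMap.ker (blackDrop t)).prod
      (LinearMap.ker (whiteDrop t fun x => t x = false)) by rw [h]
  rw [LinearMap.ker_comp, Submodule.ker_mkQ]
  ext ⟨f, g⟩
  rw [Submodule.mem_comap, mem_boundaries, Submodule.mem_prod, LinearMap.mem_ker,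
    LinearMap.mem_ker, funext_iff, funext_iff, funext_iff]
  simp only [cycleOf_snd_eq, Pi.zero_apply]
  constructor
  · refine fun h => ⟨fun x => ?_, fun x => ?_⟩
    · have hx := h x.1
      rwa [if_pos x.2] at hx
    · have hx := h x.1
      have : t x.1 = false := x.2
      rw [this, if_neg (by simp)] at hx
      exact hx
  · rintro ⟨h1, h2⟩ x
    split_ifs with hx
    · exact h1 ⟨x, hx⟩
    · exact h2 ⟨x, by simpa using hx⟩

/-- By Stokes and exactness, the remaining drops of these white functions form precisely the
annihilator of the range of `blackDrop`. Those with no drop left are constant on pieces, which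
accounts for the term `Nat.card D.Piece`. -/
theorem finrank_ker_whiteDrop (ht : D.IsColouring t) :
    finrank ℝ (LinearMap.ker (whiteDrop t fun x => t x = false)) +
      finrank ℝ (D.white fun x => !t x) =
    Nat.card D.Piece + Fintype.card {x // t x} + finrank ℝ (LinearMap.ker (blackDrop t)) := by
  let M : ({x // t x} → ℝ) →ₗ[ℝ] Module.Dual ℝ (D.white fun x => !t x) :=
    (blackDrop t).dualMap ∘ₗ (dotProductEquiv ℝ {x // t x} : _ →ₗ[ℝ] _)
  have hM : ∀ y f, M y f = ∑ x : {x // t x}, y x * D.drop (fun x => !t x) f.1 x.1 := fun y f => by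
    simp [M, blackDrop, dotProduct, LinearMap.funLeft_apply]
  let R : LinearMap.ker (whiteDrop t fun x => t x = false) →ₗ[ℝ] ({x // t x} → ℝ) :=
    (whiteDrop t fun x => t x).domRestrict
      (LinearMap.ker (whiteDrop t fun x => t x = false))
  have hker : ∀ g : LinearMap.ker (whiteDrop t fun x => t x = false), ∀ x, t x = false →
      D.drop t g.1.1 x = 0 := fun g x hx => congrFun (LinearMap.mem_ker.1 g.2) ⟨x, hx⟩
  have hR : LinearMap.range R = LinearMap.ker M := by
    ext y
    constructor
    · rintro ⟨g, rfl⟩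
      rw [LinearMap.mem_ker]
      ext f
      rw [hM]
      have h := sum_drop_mul_drop ht f.2 g.1.2
      rw [LinearMap.zero_apply, ← h]
      refine (sum_subtype_colour
        (fun x => D.drop t g.1.1 x * D.drop (fun x => !t x) f.1 x)).trans
        (Finset.sum_congr rfl fun x _ => ?_)
      cases hx : t x
      · simp [hker g x hx]
      · simp
    · intro hy
      let y' : D.Crossing → ℝ := fun x => if h : t x then y ⟨x, h⟩ else 0
      obtain ⟨k, hk, hky⟩ := exists_drop_eq ht y' fun f hf => by
        have h := LinearMap.congr_fun (LinearMap.mem_ker.1 hy) ⟨f, hf⟩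
        rw [hM, LinearMap.zero_apply] at h
        rw [← h]
        have e : ∀ x : {x // t x}, y x = y' x.1 := fun x => by simp [y', x.2]
        simp only [e]
        rw [sum_subtype_colour (fun x => y' x * D.drop (fun x => !t x) f x)]
        refine Finset.sum_congr rfl fun x _ => ?_
        split_ifs with hx
        · rfl
        · simp [y', hx]
      refine ⟨⟨⟨k, hk⟩, ?_⟩, ?_⟩
      · rw [LinearMap.mem_ker]
        ext ⟨x, hx⟩
        have hx' : t x = false := hx
        show D.drop t k x = 0
        have := hky x
        simp only [hx', y'] at this
        simpa using this
      · ext ⟨x, hx⟩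
        have hx' : t x = true := hx
        show D.drop t k x = y ⟨x, hx⟩
        have := hky x
        simp only [hx', y'] at this
        simpa using this
  have h1 := LinearMap.finrank_range_add_finrank_ker (K := ℝ)
    (V := LinearMap.ker (whiteDrop t fun x => t x = false)) (V₂ := {x // t x} → ℝ) R
  have h2 := LinearMap.finrank_range_add_finrank_ker M
  have h3 : finrank ℝ (LinearMap.range M) = finrank ℝ (LinearMap.range (blackDrop t)) := by
    rw [← LinearMap.finrank_range_dualMap_eq_finrank_range (blackDrop t),
      LinearMap.range_comp_of_range_eq_top]
    exact LinearEquiv.range _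
  have h4 := LinearMap.finrank_range_add_finrank_ker (blackDrop t)
  have h5 : finrank ℝ (LinearMap.ker R) = Nat.card D.Piece := by
    rw [← finrank_pieceConstant, ← white_inf_ker_drop (t := t)]
    refine LinearEquiv.finrank_eq
      { toFun := fun g => ⟨g.1.1.1, g.1.1.2, by
          refine LinearMap.mem_ker.2 (funext fun x => ?_)
          cases hx : t x
          · exact hker g.1 x hx
          · exact congrFun (LinearMap.mem_ker.1 g.2) ⟨x, hx⟩⟩
        invFun := fun g => ⟨⟨⟨g.1, g.2.1⟩, by
          rw [LinearMap.mem_ker]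
          ext x
          exact congrFun (LinearMap.mem_ker.1 g.2.2) x.1⟩, by
          rw [LinearMap.mem_ker]
          ext x
          exact congrFun (LinearMap.mem_ker.1 g.2.2) x.1⟩
        map_add' := fun _ _ => rfl
        map_smul' := fun _ _ => rfl
        left_inv := fun _ => rfl
        right_inv := fun _ => rfl }
  rw [Module.finrank_fintype_fun_eq_card] at h2
  rw [hR] at h1
  omega

theorem sig_diagonalForm :
    (sigNeg (diagonalForm D t) : ℤ) - sigPos (diagonalForm D t) = D.correction t ∧
      sigPos (diagonalForm D t) + sigNeg (diagonalForm D t) = Fintype.card {x // t x} := by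
  have hp : sigPos (diagonalForm D t) = (Finset.univ.filter fun x : {x // t x} =>
      D.sign x.1 = -1).card := by
    rw [diagonalForm, QuadraticForm.sigPos_weightedSumSquares, ← Set.ncard_coe_finset]
    congr 1
    ext x
    rcases realSign_eq (G := D.toGaussCode) x.1 with h | h <;> simp [h.1, h.2]
  have hn : sigNeg (diagonalForm D t) = (Finset.univ.filter fun x : {x // t x} =>
      ¬ D.sign x.1 = -1).card := by
    rw [diagonalForm, QuadraticForm.sigNeg_weightedSumSquares, ← Set.ncard_coe_finset]
    congr 1
    ext x
    rcases realSign_eq (G := D.toGaussCode) x.1 with h | h <;> simp [h.1, h.2]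
  refine ⟨?_, ?_⟩
  · have hc : D.correction t = ∑ x : {x // t x}, (D.sign x.1 : ℤ) := by
      rw [correction, ← Finset.sum_filter, ← Finset.sum_subtype_eq_sum_filter]
      simp [Finset.subtype_univ]
    rw [hc, hp, hn, Finset.card_filter, Finset.card_filter]
    push_cast
    rw [← Finset.sum_sub_distrib]
    refine Finset.sum_congr rfl fun x _ => ?_
    rcases Int.units_eq_one_or (D.sign x.1) with h | h <;> simp [h]
  · rw [hp, hn, Finset.card_filter_add_card_filter_not, Finset.card_univ]

/-- The nullspace of the symmetric pairing is the radical of its quadratic form, and the two indices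
and the radical exhaust the dimension. -/
theorem nullity_add_sig :
    D.nullity + sigPos D.symmetrisedPairing.toQuadraticMap +
      sigNeg D.symmetrisedPairing.toQuadraticMap =
      finrank ℝ D.DiscBandHomology + (D.numPieces - 1 : ℕ) := by
  have hS : finrank ℝ D.SeifertHomology = finrank ℝ D.DiscBandHomology + (D.numPieces - 1) := by
    rw [finrank_prod, Module.finrank_fintype_fun_eq_card, Fintype.card_fin]
  have hrad := QuadraticForm.sigPos_add_sigNeg_add_radical
    (Q := D.symmetrisedPairing.toQuadraticMap)
  have : Invertible (2 : ℝ) := invertibleOfNonzero two_ne_zero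
  rw [QuadraticMap.radical_eq_ker_associated, QuadraticMap.associated_left_inverse, hS] at hrad
  · rw [nullity]
    omega
  · intro x y
    exact add_comm _ _

/-- The formula of Gordon and Litherland. -/
theorem signature_nullity_eq (ht : D.IsColouring t) :
    D.signature = sigPos (D.goeritz t) - sigNeg (D.goeritz t) - D.correction t ∧
    D.nullity = (finrank ℝ (D.white t) : ℤ) - sigPos (D.goeritz t) - sigNeg (D.goeritz t) -
      Nat.card D.Piece + (D.numPieces - 1 : ℕ) := by
  have hs := symmetrisedPairing_self ht
  have hr := finrank_range_splitting (D := D) (t := t)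
  have hd := finrank_discBandHomology ht
  have hk := finrank_ker_whiteDrop ht
  have hle := (LinearMap.range (splitting t)).finrank_le
  have hW : finrank ℝ (D.white t × ({x // t x} → ℝ)) =
      finrank ℝ (D.white t) + Fintype.card {x // t x} := by
    rw [finrank_prod, Module.finrank_fintype_fun_eq_card]
  obtain ⟨c, hc⟩ := Nat.exists_eq_add_of_le hle
  have hco := sig_comp_of_coisotropic _ (splitting t) c hc.symm (splitting_coisotropic ht)
  have hprod := sig_prod (D.goeritz t) (diagonalForm D t)
  have hdiag := sig_diagonalForm (D := D) (t := t)
  refine ⟨?_, ?_⟩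
  · rw [signature]
    omega
  · have hrad := nullity_add_sig (D := D)
    omega

end LinkDiagram

end

noncomputable section

theorem finrank_comap_of_surjective {V W : Type*} [AddCommGroup V] [Module ℝ V]
    [FiniteDimensional ℝ V] [AddCommGroup W] [Module ℝ W] [FiniteDimensional ℝ W] (f : V →ₗ[ℝ] W)
    (hf : Function.Surjective f) (U : Submodule ℝ W) :
    Module.finrank ℝ (U.comap f) =
      Module.finrank ℝ U + Module.finrank ℝ (LinearMap.ker f) := by
  have h1 := LinearMap.finrank_range_add_finrank_ker f
  have h2 := LinearMap.finrank_range_add_finrank_ker (U.mkQ ∘ₗ f)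
  have h3 := U.finrank_quotient_add_finrank
  have hs : Function.Surjective (U.mkQ ∘ₗ f) := by
    rw [LinearMap.coe_comp]
    exact (Submodule.mkQ_surjective _).comp hf
  rw [LinearMap.range_eq_top.2 hf, finrank_top] at h1
  rw [LinearMap.range_eq_top.2 hs, finrank_top, LinearMap.ker_comp, Submodule.ker_mkQ] at h2
  omega

namespace GaussCode

open Module

variable {G H : GaussCode}

/-! ### Deleting crossings -/

/-- A function on the edges that does not change along the strands through the crossings in `S`. -/
def IsStraight {α : Type*} (S : Set G.Crossing) (φ : G.Crossing × Bool → α) : Prop :=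
  ∀ e, (G.succ e).1 ∈ S → φ (G.succ e) = φ e

/-- `H` arises from `G` by deleting the crossings in `S`, the others being renamed by `ι`. -/
structure Deletion (S : Set G.Crossing) (ι : H.Crossing → G.Crossing) : Prop where
  injective : Function.Injective ι
  range : Set.range ι = Sᶜ
  sign : ∀ x, H.sign x = G.sign (ι x)
  path : ∀ v : H.Crossing × Bool, ∃ k : ℕ,
    (G.succ^[k + 1]) (Prod.map ι id v) = Prod.map ι id (H.succ v) ∧
    ∀ j < k, ((G.succ^[j + 1]) (Prod.map ι id v)).1 ∈ S
  components : H.numComponents = G.numComponents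

namespace Deletion

variable {S : Set G.Crossing} {ι : H.Crossing → G.Crossing} (h : Deletion S ι)

include h

theorem notMem (x : H.Crossing) : ι x ∉ S := by
  have : ι x ∈ Sᶜ := by rw [← h.range]; exact ⟨x, rfl⟩
  exact this

theorem exists_eq {e : G.Crossing × Bool} (he : e.1 ∉ S) : ∃ v, Prod.map ι id v = e := by
  have : e.1 ∈ Set.range ι := by rw [h.range]; exact he
  obtain ⟨x, hx⟩ := this
  exact ⟨(x, e.2), Prod.ext hx rfl⟩

/-- An edge of `H` is a chain of edges of `G` through deleted crossings; a straight function has the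
same value on the first and the last edge of the chain. -/
theorem straight_pred {α : Type*} {φ : G.Crossing × Bool → α} (hφ : IsStraight S φ)
    (w : H.Crossing × Bool) :
    φ (G.succ.symm (Prod.map ι id w)) = φ (Prod.map ι id (H.succ.symm w)) := by
  obtain ⟨k, hk, hj⟩ := h.path (H.succ.symm w)
  rw [Equiv.apply_symm_apply] at hk
  rw [← hk, Function.iterate_succ_apply', Equiv.symm_apply_apply]
  clear hk
  induction k with
  | zero => rfl
  | succ k ih =>
    rw [Function.iterate_succ_apply', hφ, ih fun j hj' => hj j (by omega)]
    rw [← Function.iterate_succ_apply' (f := G.succ)]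
    exact hj k (by omega)

theorem exists_straight {α : Type*} [Zero α] (ψ : H.Crossing × Bool → α) :
    ∃ φ, IsStraight S φ ∧ φ ∘ Prod.map ι id = ψ := by
  classical
  let R : H.Crossing × Bool → G.Crossing × Bool → Prop := fun v e =>
    ∃ j, (G.succ^[j]) (Prod.map ι id v) = e ∧ ∀ i < j, ((G.succ^[i + 1]) (Prod.map ι id v)).1 ∈ S
  have hle : ∀ v v' j j', j ≤ j' → (G.succ^[j]) (Prod.map ι id v) = (G.succ^[j']) (Prod.map ι id v') →
      (∀ i < j', ((G.succ^[i + 1]) (Prod.map ι id v')).1 ∈ S) → v = v' := by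
    intro v v' j j' hjj he hS
    obtain ⟨d, rfl⟩ := Nat.exists_eq_add_of_le hjj
    rw [Function.iterate_add_apply] at he
    have he' := (G.succ.injective.iterate j) he
    cases d with
    | zero => exact (h.injective.prodMap Function.injective_id) he'
    | succ d =>
      have := hS d (by omega)
      rw [← he'] at this
      exact absurd this (h.notMem v.1)
  have huniq : ∀ v v' e, R v e → R v' e → v = v' := by
    rintro v v' e ⟨j, hj, hS⟩ ⟨j', hj', hS'⟩
    rcases le_total j j' with hjj | hjj
    · exact hle v v' j j' hjj (hj.trans hj'.symm) hS'
    · exact (hle v' v j' j hjj (hj'.trans hj.symm) hS).symm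
  -- The default `0` is taken on components all of whose crossings are deleted: no surviving visit
  -- leads to their edges.
  let φ : G.Crossing × Bool → α := fun e => if he : ∃ v, R v e then ψ he.choose else 0
  have hφ : ∀ v e, R v e → φ e = ψ v := fun v e hve => by
    have he : ∃ v, R v e := ⟨v, hve⟩
    simp only [φ, dif_pos he]
    rw [huniq _ _ e he.choose_spec hve]
  refine ⟨φ, fun e he => ?_, funext fun v => hφ v _ ⟨0, rfl, by simp⟩⟩
  by_cases hR : ∃ v, R v e
  · obtain ⟨v, j, hj, hS⟩ := hR
    rw [hφ v e ⟨j, hj, hS⟩, hφ v (G.succ e) ⟨j + 1, ?_, ?_⟩]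
    · rw [Function.iterate_succ_apply', hj]
    · intro i hi
      rcases Nat.lt_succ_iff_lt_or_eq.1 hi with hi | rfl
      · exact hS i hi
      · rw [Function.iterate_succ_apply', hj]
        exact he
  · have hR' : ¬ ∃ v, R v (G.succ e) := by
      rintro ⟨v, j, hj, hS⟩
      cases j with
      | zero =>
        rw [← hj] at he
        exact h.notMem v.1 he
      | succ j =>
        rw [Function.iterate_succ_apply'] at hj
        exact hR ⟨v, j, G.succ.injective hj, fun i hi => hS i (by omega)⟩
    simp only [φ, dif_neg hR, dif_neg hR']

end Deletion

variable (G) in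
/-- The functions that are constant on each component that meets a crossing. -/
def componentConstant : Submodule ℝ (G.Crossing × Bool → ℝ) where
  carrier := {φ | ∀ e, φ (G.succ e) = φ e}
  add_mem' ha hb e := by simp [ha e, hb e]
  zero_mem' _ := rfl
  smul_mem' c _ ha e := by simp [ha e]

theorem finrank_componentConstant :
    finrank ℝ G.componentConstant + G.circles = G.numComponents := by
  let Q := Quot fun v w => G.succ v = w
  have : Finite Q := Quot.finite _
  have := Fintype.ofFinite Q
  rw [numComponents, add_left_inj]
  let e : G.componentConstant ≃ₗ[ℝ] (Q → ℝ) :=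
    { toFun := fun φ => Quot.lift φ.1 (by rintro a b rfl; exact (φ.2 a).symm)
      invFun := fun p => ⟨fun v => p (Quot.mk _ v), fun v => by
        have hv : (Quot.mk _ v : Q) = Quot.mk _ (G.succ v) := Quot.sound rfl
        exact congrArg p hv.symm⟩
      map_add' := fun a b => by
        funext q
        induction q using Quot.ind with
        | _ v => rfl
      map_smul' := fun c a => by
        funext q
        induction q using Quot.ind with
        | _ v => rfl
      left_inv := fun _ => rfl
      right_inv := fun p => by
        funext q
        induction q using Quot.ind with
        | _ v => rfl }
  rw [e.finrank_eq, Nat.card_eq_fintype_card (α := Q)]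
  exact Module.finrank_fintype_fun_eq_card (η := Q) ℝ

/-- The straight functions as a subspace. -/
def straight (S : Set G.Crossing) : Submodule ℝ (G.Crossing × Bool → ℝ) where
  carrier := {φ | IsStraight S φ}
  add_mem' ha hb e he := by simp [ha e he, hb e he]
  zero_mem' _ _ := rfl
  smul_mem' c _ ha e he := by simp [ha e he]

/-- Restrict a function to the edges that survive a deletion. -/
def restrictEdges (ι : H.Crossing → G.Crossing) :
    (G.Crossing × Bool → ℝ) →ₗ[ℝ] (H.Crossing × Bool → ℝ) :=
  LinearMap.funLeft ℝ ℝ (Prod.map ι id)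

namespace Deletion

variable {S : Set G.Crossing} {ι : H.Crossing → G.Crossing} (h : Deletion S ι)

include h

theorem restrict_surjective :
    Function.Surjective ((restrictEdges ι).domRestrict (straight S)) := fun ψ => by
  obtain ⟨φ, hφ, rfl⟩ := h.exists_straight ψ
  exact ⟨⟨φ, hφ⟩, rfl⟩

/-- Restricting to zero leaves one free constant for each component that loses all its crossings,
and these become the new circles. The count compares functions constant on components before and
after, using that the number of components is preserved. -/
theorem finrank_ker_restrict :
    finrank ℝ (LinearMap.ker ((restrictEdges ι).domRestrict (straight S))) + G.circles =
      H.circles := by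
  have hpred : ∀ φ : G.Crossing × Bool → ℝ, φ ∈ straight S →
      restrictEdges ι φ ∈ H.componentConstant → φ ∈ G.componentConstant := by
    intro φ hφ hr e
    by_cases he : (G.succ e).1 ∈ S
    · exact hφ e he
    · obtain ⟨w, hw⟩ := h.exists_eq he
      have h1 := h.straight_pred hφ w
      rw [hw, Equiv.symm_apply_apply] at h1
      rw [h1, ← hw]
      have h2 := hr (H.succ.symm w)
      rw [Equiv.apply_symm_apply] at h2
      exact h2
  have hres : ∀ φ ∈ G.componentConstant, restrictEdges ι φ ∈ H.componentConstant := by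
    intro φ hφ w
    have h1 := h.straight_pred (fun e _ => hφ e) (H.succ w)
    rw [Equiv.symm_apply_apply] at h1
    have h2 := hφ (G.succ.symm (Prod.map ι id (H.succ w)))
    rw [Equiv.apply_symm_apply] at h2
    exact h2.trans h1
  have hle : G.componentConstant ≤ straight S := fun φ hφ e _ => hφ e
  have h1 := finrank_comap_of_surjective _ h.restrict_surjective H.componentConstant
  have h2 : (H.componentConstant.comap ((restrictEdges ι).domRestrict (straight S))) =
      G.componentConstant.comap (straight S).subtype := by
    ext φ
    exact ⟨fun hφ => hpred φ.1 φ.2 hφ, fun hφ => hres φ.1 hφ⟩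
  rw [h2, (Submodule.comapSubtypeEquivOfLe hle).finrank_eq] at h1
  have h3 := finrank_componentConstant (G := G)
  have h4 := finrank_componentConstant (G := H)
  have h5 := h.components
  omega

variable {t : G.Crossing → Bool} {σ : Equiv.Perm (G.Crossing × Bool)}

omit h in
theorem edgeColour_map (v : H.Crossing × Bool) :
    H.edgeColour (t ∘ ι) v = G.edgeColour t (Prod.map ι id v) := rfl

theorem isColouring (ht : G.IsColouring t) (ψ : G.Crossing × Bool → Bool) (hψ : IsStraight S ψ)
    (hψt : ∀ e, e.1 ∉ S ∨ (G.succ e).1 ∉ S → ψ e = G.edgeColour t e) :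
    H.IsColouring (t ∘ ι) := by
  intro v
  have h1 := h.straight_pred hψ (H.succ v)
  have h2 := ht (G.succ.symm (Prod.map ι id (H.succ v)))
  rw [Equiv.apply_symm_apply] at h2
  rw [Equiv.symm_apply_apply, hψt, hψt] at h1
  · rw [edgeColour_map, edgeColour_map, h2, h1]
  · exact Or.inl (h.notMem v.1)
  · rw [Equiv.apply_symm_apply]
    exact Or.inr (h.notMem _)

/-- Only edges with both ends deleted are moved by `σ`, so the first and the last edge of a chain
keep their values. -/
theorem pred_eq (hσ : ∀ e, e.1 ∉ S ∨ (G.succ e).1 ∉ S → σ e = e) {g : G.Crossing × Bool → ℝ}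
    (hg : g ∘ σ ∈ straight S) (w : H.Crossing × Bool) :
    g (G.succ.symm (Prod.map ι id w)) = restrictEdges ι g (H.succ.symm w) := by
  have h1 := h.straight_pred hg w
  rw [Function.comp_apply, Function.comp_apply, hσ, hσ] at h1
  · exact h1
  · exact Or.inl (h.notMem _)
  · rw [Equiv.apply_symm_apply]
    exact Or.inr (h.notMem _)

theorem whiteAt_iff (hσ : ∀ e, e.1 ∉ S ∨ (G.succ e).1 ∉ S → σ e = e) {g : G.Crossing × Bool → ℝ}
    (hg : g ∘ σ ∈ straight S) (x : H.Crossing) :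
    H.WhiteAt (t ∘ ι) (restrictEdges ι g) x ↔ G.WhiteAt t g (ι x) := by
  have h1 := h.pred_eq hσ hg (x, true)
  have h2 := h.pred_eq hσ hg (x, false)
  unfold WhiteAt inLeft inRight
  rw [← h1, ← h2]
  rfl

theorem drop_eq (hσ : ∀ e, e.1 ∉ S ∨ (G.succ e).1 ∉ S → σ e = e) {g : G.Crossing × Bool → ℝ}
    (hg : g ∘ σ ∈ straight S) (x : H.Crossing) :
    H.drop (t ∘ ι) (restrictEdges ι g) x = G.drop t g (ι x) := by
  have h1 := h.pred_eq hσ hg (x, true)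
  show _ - (if t (ι x) then _ else restrictEdges ι g (H.succ.symm (x, true))) = _
  rw [← h1]
  rfl

end Deletion

theorem Deletion.sum_eq {M : Type*} [AddCommMonoid M] {S : Finset G.Crossing}
    {ι : H.Crossing → G.Crossing} (h : Deletion (S : Set G.Crossing) ι) (F : G.Crossing → M)
    (hF : ∑ x ∈ S, F x = 0) : ∑ x, F x = ∑ x, F (ι x) := by
  rw [← Finset.sum_add_sum_compl S, hF, zero_add]
  symm
  refine Finset.sum_bij (fun x _ => ι x) (fun x _ => ?_) (fun a _ b _ hab => h.injective hab)
    (fun x hx => ?_) (fun _ _ => rfl)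
  · simpa using h.notMem x
  · have : x ∈ Set.range ι := by rw [h.range]; simpa using hx
    obtain ⟨y, hy⟩ := this
    exact ⟨y, Finset.mem_univ _, hy⟩

/-- Deleting crossings at which the Goeritz form has no contribution. -/
theorem Deletion.goeritz {S : Finset G.Crossing} {ι : H.Crossing → G.Crossing}
    (h : Deletion (S : Set G.Crossing) ι) {t : G.Crossing → Bool}
    (σ : Equiv.Perm (G.Crossing × Bool)) (hσ : ∀ e, e.1 ∉ S ∨ (G.succ e).1 ∉ S → σ e = e)
    (hS : ∀ g, (∀ x ∈ S, G.WhiteAt t g x) ↔ g ∘ σ ∈ straight (S : Set G.Crossing))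
    (hdrop : ∀ g ∈ G.white t, ∑ x ∈ S, G.index t x * (G.drop t g x * G.drop t g x) = 0)
    (hcorr : ∑ x ∈ S, (if t x then (G.sign x : ℤ) else 0) = 0) :
    sigPos (G.goeritz t) = sigPos (H.goeritz (t ∘ ι)) ∧
    sigNeg (G.goeritz t) = sigNeg (H.goeritz (t ∘ ι)) ∧
    G.correction t = H.correction (t ∘ ι) ∧
    finrank ℝ (G.white t) + G.circles = finrank ℝ (H.white (t ∘ ι)) + H.circles := by
  have hstr : ∀ g ∈ G.white t, g ∘ σ ∈ straight (S : Set G.Crossing) := fun g hg =>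
    (hS g).1 fun x _ => hg x
  have hwhite : ∀ g, g ∘ σ ∈ straight (S : Set G.Crossing) →
      (g ∈ G.white t ↔ restrictEdges ι g ∈ H.white (t ∘ ι)) := by
    intro g hg
    rw [mem_white, mem_white]
    constructor
    · exact fun hw x => (h.whiteAt_iff hσ hg x).2 (hw _)
    · intro hw x
      by_cases hx : x ∈ S
      · exact (hS g).2 hg x hx
      · obtain ⟨v, hv⟩ := h.exists_eq (e := (x, true)) hx
        obtain rfl : ι v.1 = x := congrArg Prod.fst hv
        exact (h.whiteAt_iff hσ hg v.1).1 (hw _)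
  have hres : ∀ g, restrictEdges ι (g ∘ σ) = restrictEdges ι g := fun g => by
    ext v
    exact congrArg g (hσ _ (Or.inl (h.notMem v.1)))
  let e : G.white t ≃ₗ[ℝ] (H.white (t ∘ ι)).comap
      ((restrictEdges ι).domRestrict (straight (S : Set G.Crossing))) :=
    { toFun := fun g => ⟨⟨g.1 ∘ σ, hstr g.1 g.2⟩, by
        show restrictEdges ι (g.1 ∘ σ) ∈ H.white (t ∘ ι)
        rw [hres]
        exact (hwhite _ (hstr g.1 g.2)).1 g.2⟩
      invFun := fun φ => ⟨φ.1.1 ∘ σ.symm, by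
        have hφ : (φ.1.1 ∘ σ.symm) ∘ σ = φ.1.1 := by ext; simp
        rw [hwhite _ (by rw [hφ]; exact φ.1.2), ← hres, hφ]
        exact φ.2⟩
      map_add' := fun _ _ => rfl
      map_smul' := fun _ _ => rfl
      left_inv := fun g => by ext; simp
      right_inv := fun φ => by ext; simp }
  -- Restriction is onto, and the deleted crossings add nothing to the form, so the Goeritz form of
  -- `G` is pulled back from that of `H`.
  let ρ : G.white t →ₗ[ℝ] H.white (t ∘ ι) := (restrictEdges ι).restrict fun g hg =>
    (hwhite g (hstr g hg)).1 hg
  have hρ : Function.Surjective ρ := by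
    rintro ⟨ψ, hψ⟩
    obtain ⟨φ, rfl⟩ := h.restrict_surjective ψ
    refine ⟨e.symm ⟨φ, hψ⟩, Subtype.ext ?_⟩
    show restrictEdges ι (φ.1 ∘ σ.symm) = restrictEdges ι φ.1
    rw [← hres]
    congr 1
    ext
    simp
  have hQ : G.goeritz t = (H.goeritz (t ∘ ι)).comp ρ := by
    ext g
    rw [QuadraticMap.comp_apply, goeritz_apply, goeritz_apply, h.sum_eq _ (hdrop g.1 g.2)]
    refine Finset.sum_congr rfl fun x _ => ?_
    have h1 : H.drop (t ∘ ι) (ρ g).1 x = G.drop t g.1 (ι x) := h.drop_eq hσ (hstr g.1 g.2) x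
    have h2 : H.index (t ∘ ι) x = G.index t (ι x) := by
      simp [index, realSign, h.sign]
    rw [h1, h2]
  refine ⟨?_, ?_, ?_, ?_⟩
  · rw [hQ, sigPos_comp_of_surjective _ _ hρ]
  · rw [hQ, sigNeg_comp_of_surjective _ _ hρ]
  · rw [correction, correction, h.sum_eq _ hcorr]
    refine Finset.sum_congr rfl fun x _ => ?_
    simp [h.sign]
  -- A component losing all its crossings costs one dimension of white functions and creates one
  -- circle.
  · rw [e.finrank_eq, finrank_comap_of_surjective _ h.restrict_surjective, add_assoc,
      h.finrank_ker_restrict]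

end GaussCode

end

/-! ### Invariance under relabelling and the first move -/

noncomputable section

namespace GaussCode

variable {G H : GaussCode}

theorem IsDeletion.exists_deletion {S : Set G.Crossing} (h : IsDeletion G H S) :
    ∃ ι : H.Crossing → G.Crossing, Deletion S ι := by
  obtain ⟨ι, h1, h2, h3, h4, h5⟩ := h
  exact ⟨ι, h1, h2, h3, h4, h5⟩

theorem isStraight_iff {α : Type*} {S : Set G.Crossing} {φ : G.Crossing × Bool → α} :
    IsStraight S φ ↔ ∀ v, v.1 ∈ S → φ v = φ (G.succ.symm v) := by
  constructor
  · intro h v hv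
    have := h (G.succ.symm v)
    rw [Equiv.apply_symm_apply] at this
    exact this hv
  · intro h e he
    rw [h _ he, Equiv.symm_apply_apply]

/-- If every strand passes the deleted crossings in pairs, colourings survive. -/
theorem Deletion.isColouring_of_pairs {S : Set G.Crossing} {ι : H.Crossing → G.Crossing}
    (h : Deletion S ι) {t : G.Crossing → Bool} (ht : G.IsColouring t)
    (A : Finset (G.Crossing × Bool)) (h1 : ∀ a ∈ A, a.1 ∈ S ∧ (G.succ a).1 ∈ S ∧ G.succ a ∉ A)
    (h2 : ∀ v, v.1 ∈ S → v ∈ A ∨ G.succ.symm v ∈ A) : H.IsColouring (t ∘ ι) := by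
  -- Colours alternate at each visit; flipping them on the edges between paired visits makes them
  -- constant along the deleted stretch.
  refine h.isColouring ht (fun e => xor (G.edgeColour t e) (decide (e ∈ A))) ?_ ?_
  · rw [isStraight_iff]
    intro v hv
    have hc := ht (G.succ.symm v)
    rw [Equiv.apply_symm_apply] at hc
    have h3 : G.succ.symm v ∈ A → v ∉ A := fun ha => by
      have := (h1 _ ha).2.2
      rwa [Equiv.apply_symm_apply] at this
    rcases h2 v hv with ha | ha
    · have hn : G.succ.symm v ∉ A := fun hn => h3 hn ha
      simp [hc, ha, hn]
    · simp [hc, ha, h3 ha]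
  · intro e he
    have : e ∉ A := fun ha => by
      rcases he with he | he
      · exact he (h1 e ha).1
      · exact he (h1 e ha).2.1
    simp [this]

end GaussCode

namespace LinkDiagram

open GaussCode Module

/-- Both numbers vanish only for the empty link. -/
theorem numPieces_eq_zero_iff (D : LinkDiagram) : D.numPieces = 0 ↔ D.numComponents = 0 := by
  have : Finite (Quot fun v w => D.succ v = w) := Quot.finite _
  have h : IsEmpty D.Piece ↔ IsEmpty (Quot fun v w => D.succ v = w) := by
    constructor
    · intro h
      exact ⟨fun q => by
        induction q using Quot.ind with
        | _ v => exact h.false (Quot.mk _ v.1)⟩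
    · intro h
      exact ⟨fun q => by
        induction q using Quot.ind with
        | _ x => exact h.false (Quot.mk _ (x, true))⟩
  rw [numPieces, numComponents, Nat.add_eq_zero_iff, Nat.add_eq_zero_iff, Finite.card_eq_zero_iff,
    Finite.card_eq_zero_iff, h]

/-- The signature and the nullity, together. -/
def invariants (D : LinkDiagram) : ℤ × ℤ := (D.signature, D.nullity)

variable {D D' : LinkDiagram}

/-- The number of pieces cancels in the nullity formula and leaves the circles, except that
`numPieces - 1` is truncated for the empty diagram; `hn` takes care of this case. -/
theorem invariants_eq {t : D.Crossing → Bool} {t' : D'.Crossing → Bool} (ht : D.IsColouring t)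
    (ht' : D'.IsColouring t') (hn : D.numPieces = 0 ↔ D'.numPieces = 0)
    (hs : (sigPos (D.goeritz t) : ℤ) - sigNeg (D.goeritz t) - D.correction t =
      sigPos (D'.goeritz t') - sigNeg (D'.goeritz t') - D'.correction t')
    (hd : (finrank ℝ (D.white t) : ℤ) - sigPos (D.goeritz t) - sigNeg (D.goeritz t) + D.circles =
      finrank ℝ (D'.white t') - sigPos (D'.goeritz t') - sigNeg (D'.goeritz t') + D'.circles) :
    D.invariants = D'.invariants := by
  have h1 := signature_nullity_eq ht
  have h2 := signature_nullity_eq ht'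
  have e1 : D.numPieces = Nat.card D.Piece + D.circles := rfl
  have e2 : D'.numPieces = Nat.card D'.Piece + D'.circles := rfl
  refine Prod.ext ?_ ?_
  · show D.signature = D'.signature
    rw [h1.1, h2.1, hs]
  · show D.nullity = D'.nullity
    rw [h1.2, h2.2]
    omega

/-- A deletion of crossings passed in pairs and not contributing to the Goeritz form preserves the
signature and the nullity. -/
theorem invariants_eq_of_deletion {S : Finset D.Crossing} {ι : D'.Crossing → D.Crossing}
    (h : Deletion (G := D.toGaussCode) (H := D'.toGaussCode) (S : Set D.Crossing) ι)
    {t : D.Crossing → Bool} (ht : D.IsColouring t) (A : Finset (D.Crossing × Bool))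
    (h1 : ∀ a ∈ A, a.1 ∈ S ∧ (D.succ a).1 ∈ S ∧ D.succ a ∉ A)
    (h2 : ∀ v : D.Crossing × Bool, v.1 ∈ S → v ∈ A ∨ D.succ.symm v ∈ A)
    (σ : Equiv.Perm (D.Crossing × Bool)) (hσ : ∀ e, e ∉ A → σ e = e)
    (hS : ∀ g, (∀ x ∈ S, D.WhiteAt t g x) ↔
      ∀ v : D.Crossing × Bool, v.1 ∈ S → g (σ v) = g (σ (D.succ.symm v)))
    (hdrop : ∀ g ∈ D.white t, ∑ x ∈ S, D.index t x * (D.drop t g x * D.drop t g x) = 0)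
    (hcorr : ∑ x ∈ S, (if t x then (D.sign x : ℤ) else 0) = 0) :
    D.invariants = D'.invariants := by
  have hG := h.goeritz σ (fun e he => hσ e fun ha => by
    rcases he with he | he
    · exact he (h1 e ha).1
    · exact he (h1 e ha).2.1) (fun g => (hS g).trans isStraight_iff.symm) hdrop hcorr
  refine invariants_eq ht (h.isColouring_of_pairs ht A h1 h2) ?_ ?_ ?_
  · rw [numPieces_eq_zero_iff, numPieces_eq_zero_iff, h.components]
  · rw [hG.1, hG.2.1, hG.2.2.1]
  · rw [hG.1, hG.2.1]
    have := hG.2.2.2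
    omega

theorem exists_colouring_eq (D : LinkDiagram) (x : D.Crossing) (b : Bool) :
    ∃ t, D.IsColouring t ∧ t x = b := by
  obtain ⟨t, ht⟩ := D.exists_colouring
  by_cases h : t x = b
  · exact ⟨t, ht, h⟩
  · exact ⟨_, ht.not, by cases b <;> simpa using h⟩

theorem invariants_relabel
    (h : GaussCode.IsDeletion D.toGaussCode D'.toGaussCode ∅) : D.invariants = D'.invariants := by
  obtain ⟨ι, hι⟩ := h.exists_deletion
  obtain ⟨t, ht⟩ := D.exists_colouring
  rw [← Finset.coe_empty] at hι
  exact invariants_eq_of_deletion hι ht ∅ (by simp) (by simp) 1 (by simp) (by simp) (by simp)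
    (by simp)

theorem invariants_of_kink {c : D.Crossing} {b : Bool} (hc : D.succ (c, b) = (c, !b))
    (h : GaussCode.IsDeletion D.toGaussCode D'.toGaussCode {c}) : D.invariants = D'.invariants := by
  obtain ⟨ι, hι⟩ := h.exists_deletion
  -- This colour makes the one-sided region black: the same edge then meets both white corners, so
  -- the drop and the correction at `c` vanish.
  obtain ⟨t, ht, htc⟩ := D.exists_colouring_eq c false
  rw [← Finset.coe_singleton] at hι
  have hc' : D.succ.symm (c, !b) = (c, b) := by rw [← hc, Equiv.symm_apply_apply]
  refine invariants_eq_of_deletion hι ht {(c, b)} ?_ ?_ 1 (by simp) ?_ ?_ ?_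
  · simp [hc]
  · rintro ⟨x, s⟩ hx
    obtain rfl : x = c := by simpa using hx
    by_cases hs : s = b
    · simp [hs]
    · obtain rfl : s = !b := by cases s <;> cases b <;> simp_all
      simp [hc']
  · intro g
    have hv : (∀ v : D.Crossing × Bool, v.1 ∈ ({c} : Finset D.Crossing) →
        g ((1 : Equiv.Perm (D.Crossing × Bool)) v) =
          g ((1 : Equiv.Perm (D.Crossing × Bool)) (D.succ.symm v))) ↔
        g (c, true) = g (D.inLeft c) ∧ g (c, false) = g (D.inRight c) := by
      simp [Prod.forall, inLeft, inRight, and_comm, forall_and]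
    rw [hv]
    simp only [Finset.mem_singleton, forall_eq]
    rw [whiteAt_false htc]
    unfold inLeft inRight outLeft outRight
    cases b
    · rw [Bool.not_false] at hc'
      rw [hc']
      grind
    · rw [Bool.not_true] at hc'
      rw [hc']
      grind
  · intro g hg
    have hw := hg c
    rw [whiteAt_false htc] at hw
    rw [Finset.sum_singleton, drop_false htc]
    unfold inLeft inRight outLeft outRight at *
    cases b
    · rw [Bool.not_false] at hc'
      simp [hc']
    · rw [Bool.not_true] at hc'
      rw [hc'] at hw
      simp [hw.1, hw.2]
  · simp [htc]

theorem invariants_one (d : (D.Crossing × Bool) × Bool) (hface : D.faceStep d = d)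
    (h : GaussCode.IsDeletion D.toGaussCode D'.toGaussCode {D.corner d}) :
    D.invariants = D'.invariants := by
  obtain ⟨⟨x, b⟩, s⟩ := d
  cases s
  · simp only [corner] at h
    cases b
    · simp [faceStep] at hface
    · refine invariants_of_kink (c := x) (b := true) ?_ h
      simp only [faceStep, inRight] at hface
      have := congrArg Prod.fst hface
      exact ((Equiv.symm_apply_eq _).1 this).symm
  · simp only [corner] at h
    rcases hs : D.succ (x, b) with ⟨y, c⟩
    cases c
    · simp [faceStep, hs] at hface
    · simp [faceStep, hs, outLeft] at hface
      obtain ⟨rfl, rfl⟩ := hface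
      refine invariants_of_kink (c := y) (b := false) (by simpa using hs) ?_
      simpa [hs] using h

end LinkDiagram

end

/-! ### Invariance under the second move -/

noncomputable section

namespace LinkDiagram

open GaussCode Module

variable {D D' : LinkDiagram}

theorem forall_visit_pair {x y : D.Crossing} {F : D.Crossing × Bool → Prop} :
    (∀ v : D.Crossing × Bool, v.1 ∈ ({x, y} : Finset D.Crossing) → F v) ↔
      F (x, true) ∧ F (x, false) ∧ F (y, true) ∧ F (y, false) := by
  constructor
  · intro h
    refine ⟨h _ ?_, h _ ?_, h _ ?_, h _ ?_⟩ <;> simp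
  · rintro ⟨h1, h2, h3, h4⟩ ⟨z, b⟩ hz
    simp only [Finset.mem_insert, Finset.mem_singleton] at hz
    rcases hz with rfl | rfl <;> cases b <;> assumption

theorem invariants_of_parallel_bigon {x y : D.Crossing} (hxy : x ≠ y)
    (h1 : D.succ (x, true) = (y, false)) (h2 : D.succ (x, false) = (y, true))
    (hs : D.sign y = -D.sign x)
    (h : GaussCode.IsDeletion D.toGaussCode D'.toGaussCode {x, y}) :
    D.invariants = D'.invariants := by
  obtain ⟨ι, hι⟩ := h.exists_deletion
  -- The bigon is black. The white regions to its left and right each meet both crossings, so the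
  -- drops agree, while the indices and the corrections are opposite.
  obtain ⟨t, ht, htx⟩ := D.exists_colouring_eq x true
  rw [← Finset.coe_pair] at hι
  have hty : t y = true := by
    have := ht (x, true)
    rw [h1] at this
    simpa [edgeColour, htx] using this
  have h1' : D.succ.symm (y, false) = (x, true) := by rw [← h1, Equiv.symm_apply_apply]
  have h2' : D.succ.symm (y, true) = (x, false) := by rw [← h2, Equiv.symm_apply_apply]
  have hne : ∀ s, D.succ.symm (x, s) ≠ (x, true) ∧ D.succ.symm (x, s) ≠ (x, false) := fun s => by
    rw [ne_eq, ne_eq, Equiv.symm_apply_eq, Equiv.symm_apply_eq, h1, h2]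
    simp [hxy]
  refine invariants_eq_of_deletion hι ht {(x, true), (x, false)} ?_ ?_
    -- The strands cross, so a white region touches one strand outside the bigon and the other
    -- strand along its side. Exchanging the two sides makes a white function straight.
    (Equiv.swap (x, true) (x, false)) ?_ ?_ ?_ ?_
  · simp [h1, h2, hxy.symm]
  · rw [forall_visit_pair]
    simp [h1', h2']
  · intro e he
    simp only [Finset.mem_insert, Finset.mem_singleton, not_or] at he
    exact Equiv.swap_apply_of_ne_of_ne he.1 he.2
  · intro g
    rw [forall_visit_pair, h1', h2', Equiv.swap_apply_left, Equiv.swap_apply_right,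
      Equiv.swap_apply_of_ne_of_ne (x := (y, true)) (by simp [hxy.symm]) (by simp [hxy.symm]),
      Equiv.swap_apply_of_ne_of_ne (x := (y, false)) (by simp [hxy.symm]) (by simp [hxy.symm]),
      Equiv.swap_apply_of_ne_of_ne (hne _).1 (hne _).2,
      Equiv.swap_apply_of_ne_of_ne (hne _).1 (hne _).2]
    simp only [Finset.mem_insert, Finset.mem_singleton, forall_eq_or_imp, forall_eq]
    rw [whiteAt_true htx, whiteAt_true hty]
    unfold inLeft inRight outLeft outRight
    rw [h1', h2']
    grind
  · intro g hg
    have hw := hg y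
    rw [whiteAt_true hty] at hw
    unfold inLeft inRight outLeft outRight at hw
    rw [h1', h2'] at hw
    rw [Finset.sum_pair hxy, drop_true htx, drop_true hty]
    unfold outLeft outRight
    rw [hw.1, hw.2]
    simp [index, htx, hty, realSign, hs]
  · rw [Finset.sum_pair hxy]
    simp [htx, hty, hs]

theorem invariants_of_antiparallel_bigon {x y : D.Crossing} (hxy : x ≠ y) {b : Bool}
    (h1 : D.succ (x, b) = (y, !b)) (h2 : D.succ (y, b) = (x, !b))
    (hs : D.sign y = -D.sign x)
    (h : GaussCode.IsDeletion D.toGaussCode D'.toGaussCode {x, y}) :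
    D.invariants = D'.invariants := by
  obtain ⟨ι, hι⟩ := h.exists_deletion
  -- Again the bigon is black. No correction arises with this colour, and the two drops agree up to
  -- sign.
  obtain ⟨t, ht, htx⟩ := D.exists_colouring_eq x false
  rw [← Finset.coe_pair] at hι
  have hty : t y = false := by
    have := ht (x, b)
    rw [h1] at this
    cases b <;> simpa [edgeColour, htx] using this
  have h1' : D.succ.symm (y, !b) = (x, b) := by rw [← h1, Equiv.symm_apply_apply]
  have h2' : D.succ.symm (x, !b) = (y, b) := by rw [← h2, Equiv.symm_apply_apply]
  have hne : D.succ.symm (x, b) ≠ (x, b) ∧ D.succ.symm (x, b) ≠ (y, b) ∧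
      D.succ.symm (y, b) ≠ (x, b) ∧ D.succ.symm (y, b) ≠ (y, b) := by
    rw [ne_eq, ne_eq, ne_eq, ne_eq, Equiv.symm_apply_eq, Equiv.symm_apply_eq, Equiv.symm_apply_eq,
      Equiv.symm_apply_eq, h1, h2]
    simp [hxy, hxy.symm]
  have e1 : Equiv.swap (x, b) (y, b) (x, !b) = (x, !b) :=
    Equiv.swap_apply_of_ne_of_ne (by simp) (by simp)
  have e2 : Equiv.swap (x, b) (y, b) (y, !b) = (y, !b) :=
    Equiv.swap_apply_of_ne_of_ne (by simp) (by simp)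
  have e3 := Equiv.swap_apply_of_ne_of_ne hne.1 hne.2.1
  have e4 := Equiv.swap_apply_of_ne_of_ne hne.2.2.1 hne.2.2.2
  have e5 := Equiv.swap_apply_left (x, b) (y, b)
  have e6 := Equiv.swap_apply_right (x, b) (y, b)
  refine invariants_eq_of_deletion hι ht {(x, b), (y, b)} ?_ ?_
    (Equiv.swap (x, b) (y, b)) ?_ ?_ ?_ ?_
  · simp [h1, h2]
  · rw [forall_visit_pair]
    cases b <;> simp_all
  · intro e he
    simp only [Finset.mem_insert, Finset.mem_singleton, not_or] at he
    exact Equiv.swap_apply_of_ne_of_ne he.1 he.2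
  · intro g
    rw [forall_visit_pair]
    simp only [Finset.mem_insert, Finset.mem_singleton, forall_eq_or_imp, forall_eq]
    rw [whiteAt_false htx, whiteAt_false hty]
    unfold inLeft inRight outLeft outRight
    cases b <;> simp only [Bool.not_false, Bool.not_true] at * <;>
      rw [h1', h2', e1, e2, e3, e4, e5, e6] <;> grind
  · intro g hg
    have hw := hg y
    have hw' := hg x
    rw [whiteAt_false hty] at hw
    rw [whiteAt_false htx] at hw'
    rw [Finset.sum_pair hxy, drop_false htx, drop_false hty]
    unfold inLeft inRight outLeft outRight at *
    have hr : D.realSign y = - D.realSign x := by simp [realSign, hs]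
    simp only [index, htx, hty, hr]
    cases b <;> simp only [Bool.not_false, Bool.not_true] at *
    · rw [h1', h2']
      simp
      ring
    · rw [hw.1, hw'.1, hw.2, hw'.2, h1', h2']
      simp
      ring
  · rw [Finset.sum_pair hxy]
    simp [htx, hty]

/-- The walk traverses both sides of the bigon in the same sense along their orientations when the
strands are antiparallel, and in different senses when they are parallel. A strand that is over at
both ends while entering once at the lower left and once at the lower right forces opposite signs.
-/
theorem invariants_two (d₀ d₁ : (D.Crossing × Bool) × Bool)
    (h₀ : D.faceStep d₀ = d₁) (h₁ : D.faceStep d₁ = d₀) (hne : D.corner d₀ ≠ D.corner d₁)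
    (hover : D.IsOver d₀.1 ∧ D.IsOver (D.succ d₀.1))
    (h : GaussCode.IsDeletion D.toGaussCode D'.toGaussCode {D.corner d₀, D.corner d₁}) :
    D.invariants = D'.invariants := by
  have hu : ∀ u : ℤˣ, u ≠ 1 ↔ u = -1 := fun u => by
    rcases Int.units_eq_one_or u with rfl | rfl <;> decide
  obtain ⟨⟨x, b⟩, s⟩ := d₀
  subst h₀
  rcases hsx : D.succ (x, b) with ⟨y, c⟩
  cases s
  · cases b
    · have hf : D.faceStep ((x, false), false) = ((x, true), true) := by simp [faceStep, outRight]
      rw [hf] at h₁ hne h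
      rcases hsy : D.succ (x, true) with ⟨z, c'⟩
      cases c' <;> simp [faceStep, hsy, outLeft, inLeft, Equiv.symm_apply_eq] at h₁
      rw [hsx] at h₁
      simp only [Prod.mk.injEq] at h₁
      obtain ⟨rfl, rfl⟩ := h₁
      simp only [corner, hsy, if_true] at hne h
      simp [IsOver, hsx] at hover
      exact invariants_of_parallel_bigon (by simpa using hne) hsy hsx
        (by rw [hover.2, (hu _).1 hover.1, neg_neg]) (by simpa using h)
    · have hf : D.faceStep ((x, true), false) = (D.succ.symm (x, false), false) := by
        simp [faceStep, inRight]
      rw [hf] at h₁ hne h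
      rcases hsy : D.succ.symm (x, false) with ⟨z, c'⟩
      rw [hsy] at h₁ hne h
      cases c' <;> simp [faceStep, outRight, inRight, Equiv.symm_apply_eq] at h₁
      rw [Equiv.symm_apply_eq] at hsy
      rw [hsx] at h₁
      simp only [Prod.mk.injEq] at h₁
      obtain ⟨rfl, rfl⟩ := h₁
      simp only [corner] at hne h
      simp [IsOver, hsx] at hover
      exact invariants_of_antiparallel_bigon (b := true) (by simpa using hne) hsx hsy.symm
        (by rw [hover.1, (hu _).1 hover.2]) (by simpa using h)
  · cases c
    · have hf : D.faceStep ((x, b), true) = (D.succ.symm (y, true), false) := by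
        simp [faceStep, inLeft, hsx]
      rw [hf] at h₁ hne h
      rcases hsy : D.succ.symm (y, true) with ⟨z, c'⟩
      rw [hsy] at h₁ hne h
      cases c' <;> simp [faceStep, outRight, inRight] at h₁
      obtain ⟨rfl, rfl⟩ := h₁
      rw [Equiv.symm_apply_eq] at hsy
      simp only [corner, hsx] at hne h
      simp [IsOver, hsx] at hover
      exact invariants_of_parallel_bigon (by simpa using hne.symm) hsx hsy.symm
        (by rw [hover.1, (hu _).1 hover.2]) (by rw [Set.pair_comm]; simpa using h)
    · have hf : D.faceStep ((x, b), true) = ((y, false), true) := by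
        simp [faceStep, outLeft, hsx]
      rw [hf] at h₁ hne h
      rcases hsy : D.succ (y, false) with ⟨z, c'⟩
      cases c' <;> simp [faceStep, hsy, outLeft, inLeft] at h₁
      obtain ⟨rfl, rfl⟩ := h₁
      simp only [corner, hsx, hsy] at hne h
      simp [IsOver, hsx] at hover
      exact invariants_of_antiparallel_bigon (b := false) (by simpa using hne) hsy hsx
        (by rw [hover.2, (hu _).1 hover.1]) (by simpa using h)

end LinkDiagram

end

/-! ### The triangle of the third move -/

noncomputable section

namespace GaussCode

open Module

/-- The condition at a crossing in terms of its two strands, the first one having the edges with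
values `A`, `P`, the second one those with values `A'`, `N`. -/
theorem whiteAt_iff_of_strands {G : GaussCode} {t : G.Crossing → Bool} {g : G.Crossing × Bool → ℝ}
    {x : G.Crossing} {s s' : Bool} (ht : t x = (s == s')) {A P A' N : ℝ}
    (hv : (g (G.succ.symm (x, s == s')), g (x, s == s')) = if s then (A, P) else (P, A))
    (hu : (g (G.succ.symm (x, !(s == s'))), g (x, !(s == s'))) =
      if s' then (N, A') else (A', N)) :
    (G.WhiteAt t g x ↔ A = A' ∧ P = N) ∧
      (G.WhiteAt t g x → G.drop t g x * G.drop t g x = (A - P) * (A - P)) := by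
  cases s <;> cases s' <;> simp at hv hu ht <;> obtain ⟨h1, h2⟩ := hv <;> obtain ⟨h3, h4⟩ := hu
  all_goals
    first
    | rw [whiteAt_true ht, drop_true ht]
    | rw [whiteAt_false ht, drop_false ht]
    unfold inLeft inRight outLeft outRight
    simp only [h1, h2, h3, h4]
    constructor
    · grind
    · rintro ⟨e1, e2⟩
      subst e1 e2
      ring

/-- A triangular region. Its `i`-th side is the edge `a i`, which is traversed with the region on the
left along its orientation if `s i`, and ends at the crossing `c i` in this direction. -/
structure Triangle (G : GaussCode) where
  c : Fin 3 → G.Crossing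
  a : Fin 3 → G.Crossing × Bool
  s : Fin 3 → Bool
  injective : Function.Injective c
  first : ∀ i, (c i, s i == s (i + 1)) = if s i then G.succ (a i) else a i
  second : ∀ i, (c i, !(s i == s (i + 1))) = if s (i + 1) then a (i + 1) else G.succ (a (i + 1))

theorem corner_visits (G : GaussCode) (d : (G.Crossing × Bool) × Bool) :
    (G.corner d, d.2 == (G.faceStep d).2) = (if d.2 then G.succ d.1 else d.1) ∧
    (G.corner d, !(d.2 == (G.faceStep d).2)) =
      if (G.faceStep d).2 then (G.faceStep d).1 else G.succ (G.faceStep d).1 := by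
  obtain ⟨⟨x, b⟩, s⟩ := d
  cases s
  · cases b <;> simp [faceStep, corner, inRight, outRight]
  · rcases h : G.succ (x, b) with ⟨y, c⟩
    cases c <;> simp [faceStep, corner, inLeft, outLeft, h]

namespace Triangle

variable {G : GaussCode} (T : Triangle G)

theorem add_two_add_one (i : Fin 3) : i + 2 + 1 = i := by revert i; decide

theorem end_eq {i : Fin 3} {z : G.Crossing × Bool} (hz : z = T.a i ∨ z = G.succ (T.a i)) :
    z = (T.c i, T.s i == T.s (i + 1)) ∨ z = (T.c (i + 2), !(T.s (i + 2) == T.s i)) := by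
  have h1 := T.first i
  have h2 := T.second (i + 2)
  rw [add_two_add_one] at h2
  rw [h1, h2]
  rcases hz with rfl | rfl <;> cases T.s i <;> simp

theorem eq_of_end {i j : Fin 3} {z : G.Crossing × Bool} (hi : z = T.a i ∨ z = G.succ (T.a i))
    (hj : z = T.a j ∨ z = G.succ (T.a j)) : i = j := by
  rcases T.end_eq hi with h1 | h1 <;> rcases T.end_eq hj with h2 | h2 <;>
    rw [h1, Prod.mk.injEq] at h2 <;> have h3 := T.injective h2.1
  · exact h3
  · subst h3
    have := h2.2
    rw [add_two_add_one] at this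
    simp at this
  · subst h3
    have := h2.2
    rw [add_two_add_one] at this
    simp at this
  · simpa using h3

theorem a_injective : Function.Injective T.a := fun _ _ h => T.eq_of_end (Or.inl rfl) (Or.inl h)

/-- Otherwise both ends of a side would be the same visit, and two corners would coincide. -/
theorem a_ne_succ (i j : Fin 3) : T.a i ≠ G.succ (T.a j) := by
  intro h
  obtain rfl : i = j := T.eq_of_end (Or.inl rfl) (Or.inr h)
  have h1 := T.first i
  have h2 := T.second (i + 2)
  rw [add_two_add_one] at h2
  have h3 : T.c i = T.c (i + 2) := by
    have h4 : (T.c i, T.s i == T.s (i + 1)) = (T.c (i + 2), !(T.s (i + 2) == T.s i)) := by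
      rw [h1, h2]
      split_ifs
      · exact h.symm
      · exact h
    exact congrArg Prod.fst h4
  have := T.injective h3
  revert this
  clear h1 h2 h3 h
  revert i
  decide

/-- The crossings of the triangle. -/
def corners : Finset G.Crossing := Finset.univ.image T.c

theorem mem_corners {x : G.Crossing} : x ∈ T.corners ↔ ∃ i, T.c i = x := by simp [corners]

theorem end_mem_corners {i : Fin 3} {z : G.Crossing × Bool} (hz : z = T.a i ∨ z = G.succ (T.a i)) :
    z.1 ∈ T.corners := by
  rw [mem_corners]
  rcases T.end_eq hz with h | h
  · exact ⟨i, by rw [h]⟩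
  · exact ⟨i + 2, by rw [h]⟩

theorem exists_end {z : G.Crossing × Bool} (hz : z.1 ∈ T.corners) :
    ∃ i, z = T.a i ∨ z = G.succ (T.a i) := by
  rw [mem_corners] at hz
  obtain ⟨i, hi⟩ := hz
  by_cases hb : z.2 = (T.s i == T.s (i + 1))
  · have : z = if T.s i then G.succ (T.a i) else T.a i := by
      rw [← T.first i]
      exact Prod.ext hi.symm hb
    refine ⟨i, ?_⟩
    rw [this]
    split_ifs <;> simp
  · have : z = if T.s (i + 1) then T.a (i + 1) else G.succ (T.a (i + 1)) := by
      rw [← T.second i]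
      exact Prod.ext hi.symm (by rw [← Bool.not_eq.2 hb, Bool.not_not])
    refine ⟨i + 1, ?_⟩
    rw [this]
    split_ifs <;> simp

/-- The other edge of the `i`-th strand at `c i`. -/
def p (i : Fin 3) : G.Crossing × Bool := if T.s i then G.succ (T.a i) else G.succ.symm (T.a i)

/-- The other edge of the `i`-th strand at its other end. -/
def n (i : Fin 3) : G.Crossing × Bool := if T.s i then G.succ.symm (T.a i) else G.succ (T.a i)

theorem pred_ne (i j : Fin 3) : G.succ.symm (T.a i) ≠ T.a j := fun h => by
  rw [Equiv.symm_apply_eq] at h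
  exact T.a_ne_succ i j h

theorem p_ne (i j : Fin 3) : T.p i ≠ T.a j := by
  unfold p
  split_ifs
  · exact (T.a_ne_succ j i).symm
  · exact T.pred_ne i j

theorem n_ne (i j : Fin 3) : T.n i ≠ T.a j := by
  unfold n
  split_ifs
  · exact T.pred_ne i j
  · exact (T.a_ne_succ j i).symm

/-- The colouring `t` makes the triangle white. -/
def IsWhite (t : G.Crossing → Bool) : Prop := ∀ i, t (T.c i) = (T.s i == T.s (i + 1))

variable {T} {t : G.Crossing → Bool}

/-- Whiteness of the triangle propagates from one corner to the next along the side joining them. -/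
theorem isWhite_of (ht : G.IsColouring t) (h0 : t (T.c 0) = (T.s 0 == T.s (0 + 1))) :
    T.IsWhite t := by
  have step : ∀ i, t (T.c i) = (T.s i == T.s (i + 1)) →
      t (T.c (i + 1)) = (T.s (i + 1) == T.s (i + 1 + 1)) := by
    intro i hi
    have h1 := T.second i
    have h2 := T.first (i + 1)
    have h3 := ht (T.a (i + 1))
    split_ifs at h1 h2
    · rw [← h2, ← h1] at h3
      simp only [edgeColour, hi] at h3
      exact Eq.symm (by simpa using h3)
    · rw [← h1, ← h2] at h3
      simp only [edgeColour, hi] at h3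
      exact Eq.symm (by simpa using h3)
  intro i
  fin_cases i
  · exact h0
  · exact step 0 h0
  · exact step 1 (step 0 h0)

theorem IsWhite.whiteAt_iff (ht : T.IsWhite t) (g : G.Crossing × Bool → ℝ) (i : Fin 3) :
    (G.WhiteAt t g (T.c i) ↔ g (T.a i) = g (T.a (i + 1)) ∧ g (T.p i) = g (T.n (i + 1))) ∧
      (G.WhiteAt t g (T.c i) → G.drop t g (T.c i) * G.drop t g (T.c i) =
        (g (T.a i) - g (T.p i)) * (g (T.a i) - g (T.p i))) := by
  apply whiteAt_iff_of_strands (ht i)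
  · rw [T.first i]
    unfold p
    split_ifs <;> simp
  · rw [T.second i]
    unfold n
    split_ifs <;> simp

/-- The sum over all crossings, the corners of a triangle being singled out. -/
theorem sum_eq {M : Type*} [AddCommMonoid M] (F : G.Crossing → M) :
    ∑ x, F x = ∑ i, F (T.c i) + ∑ x ∈ T.cornersᶜ, F x := by
  rw [← Finset.sum_add_sum_compl T.corners]
  congr 1
  exact Finset.sum_image fun _ _ _ _ h => T.injective h

end Triangle

end GaussCode

end

/-! ### White functions before and after the third move -/

noncomputable section

namespace GaussCode

open Module

/-- `H` arises from `G` by moving a strand across the triangle `T`: each of the three strands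
interchanges its two visits to the corners. -/
structure TriangleMove {G : GaussCode} (T : Triangle G) (H : GaussCode) where
  π : Equiv.Perm (G.Crossing × Bool)
  e : G.Crossing ≃ H.Crossing
  sign : ∀ x, H.sign (e x) = G.sign x
  succ : ∀ v, H.succ (Prod.map e id (π v)) = Prod.map e id (π (G.succ v))
  map_a : ∀ i, π (T.a i) = G.succ (T.a i)
  map_succ : ∀ i, π (G.succ (T.a i)) = T.a i
  map_other : ∀ v, v.1 ∉ T.corners → π v = v

namespace TriangleMove

variable {G H : GaussCode} {T : Triangle G} (m : TriangleMove T H)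

theorem map_map (v : G.Crossing × Bool) : m.π (m.π v) = v := by
  by_cases hv : v.1 ∈ T.corners
  · obtain ⟨i, rfl | rfl⟩ := T.exists_end hv
    · rw [m.map_a, m.map_succ]
    · rw [m.map_succ, m.map_a]
  · rw [m.map_other v hv, m.map_other v hv]

theorem pred_map (w : G.Crossing × Bool) :
    H.succ.symm (Prod.map m.e id w) = Prod.map m.e id (m.π (G.succ.symm (m.π w))) := by
  rw [Equiv.symm_apply_eq, m.succ, Equiv.apply_symm_apply, map_map]

/-- Functions on the edges after the move as functions on the edges before the move, an edge being
identified with the one in the same place on its strand. -/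
def pull : (H.Crossing × Bool → ℝ) ≃ₗ[ℝ] (G.Crossing × Bool → ℝ) :=
  LinearEquiv.funCongrLeft ℝ ℝ (m.π.trans (m.e.prodCongr (Equiv.refl Bool)))

theorem pull_apply (g : H.Crossing × Bool → ℝ) (v : G.Crossing × Bool) :
    m.pull g v = g (Prod.map m.e id (m.π v)) := rfl

theorem apply_eq_pull (g : H.Crossing × Bool → ℝ) (w : G.Crossing × Bool) :
    g (Prod.map m.e id w) = m.pull g (m.π w) := by rw [pull_apply, map_map]

theorem apply_pred_eq_pull (g : H.Crossing × Bool → ℝ) (w : G.Crossing × Bool) :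
    g (H.succ.symm (Prod.map m.e id w)) = m.pull g (G.succ.symm (m.π w)) := by
  rw [pred_map, pull_apply]

/-- The colouring after the move: the colours at the corners of the triangle are exchanged. -/
def colour (t : G.Crossing → Bool) (y : H.Crossing) : Bool :=
  xor (t (m.e.symm y)) (decide (m.e.symm y ∈ T.corners))

variable {t : G.Crossing → Bool}

theorem colour_corner (i : Fin 3) : m.colour t (m.e (T.c i)) = !t (T.c i) := by
  have : T.c i ∈ T.corners := T.mem_corners.2 ⟨i, rfl⟩
  simp [colour, this]

theorem colour_other {x : G.Crossing} (hx : x ∉ T.corners) : m.colour t (m.e x) = t x := by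
  simp [colour, hx]

/-- Exchanging the two visits of a strand and flipping the colours at the corners cancel: an edge in
the same place on its strand keeps its colours. -/
theorem edgeColour_map (ht : G.IsColouring t) (v : G.Crossing × Bool) :
    H.edgeColour (m.colour t) (Prod.map m.e id (m.π v)) = G.edgeColour t v := by
  have h1 : ∀ w : G.Crossing × Bool, H.edgeColour (m.colour t) (Prod.map m.e id w) =
      xor (G.edgeColour t w) (decide (w.1 ∈ T.corners)) := fun w => by
    simp [edgeColour, colour]
  rw [h1]
  by_cases hv : v.1 ∈ T.corners
  · obtain ⟨i, hi⟩ := T.exists_end hv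
    have h2 : (m.π v).1 ∈ T.corners := by
      refine T.end_mem_corners (i := i) ?_
      rcases hi with rfl | rfl
      · exact Or.inr (m.map_a i)
      · exact Or.inl (m.map_succ i)
    have h3 := ht (T.a i)
    rcases hi with rfl | rfl
    · rw [m.map_a] at h2 ⊢
      simp [h2, h3]
    · rw [m.map_succ] at h2 ⊢
      simp [h2, h3]
  · rw [m.map_other v hv]
    simp [hv]

theorem isColouring (ht : G.IsColouring t) : H.IsColouring (m.colour t) := by
  intro w
  obtain ⟨v, rfl⟩ : ∃ v, Prod.map m.e id (m.π v) = w :=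
    ⟨m.π (Prod.map m.e.symm id w), by rw [map_map]; ext <;> simp⟩
  rw [m.succ, m.edgeColour_map ht, m.edgeColour_map ht, ht]

/-- At `c i` each strand now uses its edges in reversed roles and the opposite pair of corners is
white. The new triangle is black, and the three outer white regions meet pairwise at its corners. -/
theorem whiteAt_corner (ht : T.IsWhite t) (g : H.Crossing × Bool → ℝ) (i : Fin 3) :
    (H.WhiteAt (m.colour t) g (m.e (T.c i)) ↔
      m.pull g (T.a (i + 1)) = m.pull g (T.n i) ∧ m.pull g (T.p (i + 1)) = m.pull g (T.a i)) ∧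
      (H.WhiteAt (m.colour t) g (m.e (T.c i)) →
        H.drop (m.colour t) g (m.e (T.c i)) * H.drop (m.colour t) g (m.e (T.c i)) =
        (m.pull g (T.a (i + 1)) - m.pull g (T.p (i + 1))) *
          (m.pull g (T.a (i + 1)) - m.pull g (T.p (i + 1)))) := by
  have hs : (T.s (i + 1) == !T.s i) = !(T.s i == T.s (i + 1)) := by
    cases T.s i <;> cases T.s (i + 1) <;> rfl
  have h1 : m.π (T.c i, T.s i == T.s (i + 1)) = if T.s i then T.a i else G.succ (T.a i) := by
    rw [T.first i]
    split_ifs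
    · exact m.map_succ i
    · exact m.map_a i
  have h2 : m.π (T.c i, !(T.s i == T.s (i + 1))) =
      if T.s (i + 1) then G.succ (T.a (i + 1)) else T.a (i + 1) := by
    rw [T.second i]
    split_ifs
    · exact m.map_a _
    · exact m.map_succ _
  apply whiteAt_iff_of_strands (s := T.s (i + 1)) (s' := !T.s i)
  · rw [m.colour_corner, ht i, hs]
  · have e1 := m.apply_eq_pull g (T.c i, !(T.s i == T.s (i + 1)))
    have e2 := m.apply_pred_eq_pull g (T.c i, !(T.s i == T.s (i + 1)))
    rw [h2] at e1 e2
    simp only [Prod.map_apply, id] at e1 e2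
    rw [hs, e1, e2]
    unfold Triangle.p
    split_ifs <;> simp
  · have e1 := m.apply_eq_pull g (T.c i, T.s i == T.s (i + 1))
    have e2 := m.apply_pred_eq_pull g (T.c i, T.s i == T.s (i + 1))
    rw [h1] at e1 e2
    simp only [Prod.map_apply, id] at e1 e2
    rw [hs, Bool.not_not, e1, e2]
    unfold Triangle.n
    cases T.s i <;> simp

theorem whiteAt_other {x : G.Crossing} (hx : x ∉ T.corners) (g : H.Crossing × Bool → ℝ) :
    (H.WhiteAt (m.colour t) g (m.e x) ↔ G.WhiteAt t (m.pull g) x) ∧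
      H.drop (m.colour t) g (m.e x) = G.drop t (m.pull g) x := by
  have h1 : ∀ b, g (m.e x, b) = m.pull g (x, b) := fun b => by
    have := m.apply_eq_pull g (x, b)
    rwa [m.map_other (x, b) hx] at this
  have h2 : ∀ b, g (H.succ.symm (m.e x, b)) = m.pull g (G.succ.symm (x, b)) := fun b => by
    have := m.apply_pred_eq_pull g (x, b)
    rwa [m.map_other (x, b) hx] at this
  have h3 := m.colour_other (t := t) hx
  constructor
  · unfold WhiteAt inLeft inRight outLeft outRight
    rw [h1, h1, h2, h2, h3]
  · show g _ - (if _ then g _ else g _) = _ - (if _ then _ else _)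
    unfold inLeft outLeft outRight
    rw [h1, h1, h2, h3]

theorem mem_white_iff (ht : T.IsWhite t) {g : H.Crossing × Bool → ℝ} :
    g ∈ H.white (m.colour t) ↔
      (∀ i, m.pull g (T.a (i + 1)) = m.pull g (T.n i) ∧
        m.pull g (T.p (i + 1)) = m.pull g (T.a i)) ∧
      ∀ x, x ∉ T.corners → G.WhiteAt t (m.pull g) x := by
  rw [mem_white]
  constructor
  · exact fun h => ⟨fun i => (m.whiteAt_corner ht g i).1.1 (h _),
      fun x hx => (m.whiteAt_other hx g).1.1 (h _)⟩
  · rintro ⟨h1, h2⟩ y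
    obtain ⟨x, rfl⟩ := m.e.surjective y
    by_cases hx : x ∈ T.corners
    · obtain ⟨i, rfl⟩ := T.mem_corners.1 hx
      exact (m.whiteAt_corner ht g i).1.2 (h1 i)
    · exact (m.whiteAt_other hx g).1.2 (h2 x hx)

end TriangleMove

end GaussCode

end

/-! ### The star–triangle transformation -/

noncomputable section

namespace GaussCode

open Module

variable {G H : GaussCode} {T : Triangle G} {t : G.Crossing → Bool}

theorem index_eq (x : G.Crossing) : G.index t x = 1 ∨ G.index t x = -1 := by
  unfold index
  rcases realSign_eq x with ⟨-, h⟩ | ⟨-, h⟩ <;> rw [h] <;> split_ifs <;> simp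

namespace Triangle

theorem mem_white_iff (ht : T.IsWhite t) {g : G.Crossing × Bool → ℝ} :
    g ∈ G.white t ↔
      (∀ i, g (T.a i) = g (T.a (i + 1)) ∧ g (T.p i) = g (T.n (i + 1))) ∧
      ∀ x, x ∉ T.corners → G.WhiteAt t g x := by
  rw [mem_white]
  constructor
  · exact fun h => ⟨fun i => (ht.whiteAt_iff g i).1.1 (h _), fun x _ => h x⟩
  · rintro ⟨h1, h2⟩ x
    by_cases hx : x ∈ T.corners
    · obtain ⟨i, rfl⟩ := T.mem_corners.1 hx
      exact (ht.whiteAt_iff g i).1.2 (h1 i)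
    · exact h2 x hx

theorem congr_other {f g : G.Crossing × Bool → ℝ} (h : ∀ v, (∀ i, v ≠ T.a i) → f v = g v)
    {x : G.Crossing} (hx : x ∉ T.corners) :
    (G.WhiteAt t f x ↔ G.WhiteAt t g x) ∧ G.drop t f x = G.drop t g x := by
  have h1 : ∀ b, f (x, b) = g (x, b) := fun b => h _ fun i hi => by
    have := T.end_mem_corners (Or.inl hi)
    exact hx this
  have h2 : ∀ b, f (G.succ.symm (x, b)) = g (G.succ.symm (x, b)) := fun b => h _ fun i hi => by
    rw [Equiv.symm_apply_eq] at hi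
    have := T.end_mem_corners (Or.inr hi)
    exact hx this
  constructor
  · unfold WhiteAt inLeft inRight outLeft outRight
    rw [h1, h1, h2, h2]
  · show f _ - (if _ then f _ else f _) = _ - (if _ then _ else _)
    unfold inLeft outLeft outRight
    rw [h1, h1, h2]

variable (T)

/-- The map of edges transporting functions on the white regions past the triangle. -/
def shift : G.Crossing × Bool → G.Crossing × Bool := Function.extend T.a (fun i => T.p (i + 1)) id

theorem shift_a (i : Fin 3) : T.shift (T.a i) = T.p (i + 1) := T.a_injective.extend_apply _ _ i

theorem shift_of_ne {v : G.Crossing × Bool} (hv : ∀ i, v ≠ T.a i) : T.shift v = v :=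
  Function.extend_apply' _ _ _ fun ⟨i, hi⟩ => hv i hi.symm

end Triangle

/-- Completing the square for the three crossings of a triangle. -/
theorem star_triangle {η : Fin 3 → ℝ} (hη : ∀ i, η i = 1 ∨ η i = -1)
    (h : ∃ i, η i = 1 ∧ η (i + 2) = -1) :
    (∑ i, η i = 1 ∨ ∑ i, η i = -1) ∧ ∀ (w : ℝ) (E : Fin 3 → ℝ),
      ∑ i, η i * ((w - E i) * (w - E i)) =
        ∑ i, -η i * ((E (i + 2) - E (i + 1)) * (E (i + 2) - E (i + 1))) +
        (∑ i, η i) * ((w - (∑ i, η i) * ∑ i, η i * E i) * (w - (∑ i, η i) * ∑ i, η i * E i)) := by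
  have e3 : (2 : Fin 3) + 1 = 0 := rfl
  have e4 : (1 : Fin 3) + 2 = 0 := rfl
  have e5 : (2 : Fin 3) + 2 = 1 := rfl
  have e6 : (1 : Fin 3) + 1 = 2 := rfl
  simp only [Fin.sum_univ_three, zero_add, e3, e4, e5, e6]
  -- Two of the indices cancel, so their sum is the third one and equals `±1`.
  have h0 : (η 0 = 1 ∧ η 2 = -1) ∨ (η 1 = 1 ∧ η 0 = -1) ∨ (η 2 = 1 ∧ η 1 = -1) := by
    obtain ⟨i, hi⟩ := h
    fin_cases i
    · exact Or.inl hi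
    · exact Or.inr (Or.inl hi)
    · exact Or.inr (Or.inr hi)
  rcases h0 with ⟨h1, h2⟩ | ⟨h1, h2⟩ | ⟨h1, h2⟩
  · rcases hη 1 with h3 | h3 <;> rw [h1, h2, h3] <;> refine ⟨by norm_num, fun w E => by ring⟩
  · rcases hη 2 with h3 | h3 <;> rw [h1, h2, h3] <;> refine ⟨by norm_num, fun w E => by ring⟩
  · rcases hη 0 with h3 | h3 <;> rw [h1, h2, h3] <;> refine ⟨by norm_num, fun w E => by ring⟩

namespace TriangleMove

variable (m : TriangleMove T H)

theorem index_corner (i : Fin 3) :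
    H.index (m.colour t) (m.e (T.c i)) = -G.index t (T.c i) := by
  unfold index realSign
  rw [m.colour_corner, m.sign]
  cases t (T.c i) <;> simp

theorem index_other {x : G.Crossing} (hx : x ∉ T.corners) :
    H.index (m.colour t) (m.e x) = G.index t x := by
  unfold index realSign
  rw [m.colour_other hx, m.sign]

theorem sum_eq (F : H.Crossing → ℝ) :
    ∑ y, F y = ∑ i, F (m.e (T.c i)) + ∑ x ∈ T.cornersᶜ, F (m.e x) := by
  rw [← m.e.sum_comp, T.sum_eq]

/-- Each corner is counted in exactly one of the two corrections, because its colour is flipped; the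
sign with which it enters the difference is its index. -/
theorem correction_sub :
    (G.correction t : ℝ) - H.correction (m.colour t) = ∑ i, G.index t (T.c i) := by
  simp only [correction, Int.cast_sum, apply_ite (Int.cast : ℤ → ℝ)]
  rw [m.sum_eq, T.sum_eq]
  have : ∀ x ∈ T.cornersᶜ, (if m.colour t (m.e x) = true then ((H.sign (m.e x) : ℤ) : ℝ)
      else ((0 : ℤ) : ℝ)) = if t x = true then ((G.sign x : ℤ) : ℝ) else ((0 : ℤ) : ℝ) :=
    fun x hx => by rw [m.colour_other (Finset.mem_compl.1 hx), m.sign]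
  rw [Finset.sum_congr rfl this, add_sub_add_right_eq_sub, ← Finset.sum_sub_distrib]
  refine Finset.sum_congr rfl fun i _ => ?_
  rw [m.colour_corner, m.sign]
  unfold index realSign
  cases t (T.c i) <;> simp

theorem transport_mem (ht : T.IsWhite t) {g : G.Crossing × Bool → ℝ} (hg : g ∈ G.white t) :
    m.pull.symm (g ∘ T.shift) ∈ H.white (m.colour t) := by
  rw [T.mem_white_iff ht] at hg
  rw [m.mem_white_iff ht, LinearEquiv.apply_symm_apply]
  refine ⟨fun i => ?_, fun x hx => ?_⟩
  · simp only [Function.comp_apply, T.shift_a, T.shift_of_ne (T.p_ne _), T.shift_of_ne (T.n_ne _)]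
    have := (hg.1 (i + 2)).2
    rw [Triangle.add_two_add_one] at this
    exact ⟨by rw [add_assoc]; exact this, trivial⟩
  · refine (Triangle.congr_other (fun v hv => ?_) hx).1.1 (hg.2 x hx)
    rw [Function.comp_apply, T.shift_of_ne hv]

/-- Functions on the white regions are transported past the triangle, the value at the triangle
being recorded in a suitable affine coordinate. -/
def transport (ht : T.IsWhite t) : G.white t →ₗ[ℝ] H.white (m.colour t) × (Unit → ℝ) :=
  LinearMap.prod
    (((m.pull.symm.toLinearMap ∘ₗ LinearMap.funLeft ℝ ℝ T.shift).restrict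
      fun _ hg => m.transport_mem ht hg))
    (LinearMap.pi fun _ => (LinearMap.proj (T.a 0) - (∑ i, G.index t (T.c i)) •
      ∑ i, G.index t (T.c i) • LinearMap.proj (T.p i)) ∘ₗ (G.white t).subtype)

theorem pull_transport (ht : T.IsWhite t) (g : G.white t) :
    m.pull (m.transport ht g).1.1 = g.1 ∘ T.shift :=
  m.pull.apply_symm_apply _

theorem transport_snd (ht : T.IsWhite t) (g : G.white t) :
    (m.transport ht g).2 () = g.1 (T.a 0) -
      (∑ i, G.index t (T.c i)) * ∑ i, G.index t (T.c i) * g.1 (T.p i) := by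
  simp [transport]

theorem a_eq_a_zero (ht : T.IsWhite t) {g : G.Crossing × Bool → ℝ} (hg : g ∈ G.white t)
    (i : Fin 3) : g (T.a i) = g (T.a 0) := by
  have h := fun i => (((T.mem_white_iff ht).1 hg).1 i).1
  fin_cases i
  · rfl
  · exact (h 0).symm
  · exact h 2

/-- The first component determines the function away from the sides of the triangle, and the affine
coordinate then determines its value on the triangle; both can be prescribed freely. -/
theorem transport_bijective (ht : T.IsWhite t) : Function.Bijective (m.transport ht) := by
  constructor
  · rw [← LinearMap.ker_eq_bot, LinearMap.ker_eq_bot']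
    intro g hg
    have h1 : g.1 ∘ T.shift = 0 := by rw [← m.pull_transport ht, hg]; simp
    have hp : ∀ i, g.1 (T.p i) = 0 := fun i => by
      have := congrFun h1 (T.p i)
      rwa [Function.comp_apply, T.shift_of_ne (T.p_ne i)] at this
    have h2 := m.transport_snd ht g
    rw [hg] at h2
    simp only [hp, mul_zero, Finset.sum_const_zero, sub_zero] at h2
    apply Subtype.ext
    funext v
    by_cases hv : ∃ i, v = T.a i
    · obtain ⟨i, rfl⟩ := hv
      rw [a_eq_a_zero ht g.2, ← h2]
      rfl
    · rw [not_exists] at hv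
      have := congrFun h1 v
      rwa [Function.comp_apply, T.shift_of_ne hv] at this
  · rintro ⟨f, z⟩
    have hf := (m.mem_white_iff ht).1 f.2
    set h := m.pull f.1 with hh
    set g : G.Crossing × Bool → ℝ := Function.extend T.a (fun _ => z () +
      (∑ i, G.index t (T.c i)) * ∑ i, G.index t (T.c i) * h (T.p i)) h with hg
    have ga : ∀ i, g (T.a i) = _ := fun i => T.a_injective.extend_apply _ _ i
    have gn : ∀ v, (∀ i, v ≠ T.a i) → g v = h v := fun v hv =>
      Function.extend_apply' _ _ _ fun ⟨i, hi⟩ => hv i hi.symm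
    have hw : g ∈ G.white t := by
      rw [T.mem_white_iff ht]
      refine ⟨fun i => ⟨by rw [ga, ga], ?_⟩, fun x hx =>
        (Triangle.congr_other gn hx).1.2 (hf.2 x hx)⟩
      rw [gn _ (T.p_ne i), gn _ (T.n_ne (i + 1)), ← (hf.1 (i + 1)).1]
      have := (hf.1 (i + 2)).2
      rw [Triangle.add_two_add_one] at this
      rw [this, add_assoc]
      rfl
    refine ⟨⟨g, hw⟩, Prod.ext (Subtype.ext ?_) (funext fun _ => ?_)⟩
    · apply m.pull.injective
      rw [m.pull_transport ht]
      funext v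
      by_cases hv : ∃ i, v = T.a i
      · obtain ⟨i, rfl⟩ := hv
        rw [Function.comp_apply, T.shift_a]
        exact (gn _ (T.p_ne _)).trans (hf.1 i).2
      · rw [not_exists] at hv
        rw [Function.comp_apply, T.shift_of_ne hv]
        exact gn v hv
    · have := m.transport_snd ht ⟨g, hw⟩
      refine this.trans ?_
      simp only [ga, gn _ (T.p_ne _)]
      exact add_sub_cancel_right _ _

/-- The old triangle is the centre of a star joined to three white regions. Completing the square in
its value `w` leaves the form of the new triangle, with opposite indices, and a single square. -/
theorem goeritz_eq (ht : T.IsWhite t)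
    (h : ∃ i, G.index t (T.c i) = 1 ∧ G.index t (T.c (i + 2)) = -1) :
    G.goeritz t = (QuadraticMap.prod (H.goeritz (m.colour t))
      (QuadraticMap.weightedSumSquares ℝ fun _ : Unit => ∑ i, G.index t (T.c i))).comp
        (m.transport ht) := by
  ext g
  have hs := (star_triangle (fun i => index_eq (t := t) (T.c i)) h).2 (g.1 (T.a 0))
    fun i => g.1 (T.p i)
  have hd := fun i => (ht.whiteAt_iff g.1 i).2 (g.2 _)
  have hd' := fun i => (m.whiteAt_corner ht _ i).2 ((m.transport ht g).1.2 (m.e (T.c i)))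
  simp only [m.pull_transport, Function.comp_apply, T.shift_a, T.shift_of_ne (T.p_ne _)] at hd'
  have ho : ∀ x ∈ T.cornersᶜ, H.index (m.colour t) (m.e x) *
      (H.drop (m.colour t) (m.transport ht g).1.1 (m.e x) *
        H.drop (m.colour t) (m.transport ht g).1.1 (m.e x)) =
      G.index t x * (G.drop t g.1 x * G.drop t g.1 x) := fun x hx => by
    rw [Finset.mem_compl] at hx
    rw [m.index_other hx, (m.whiteAt_other hx _).2, m.pull_transport,
      (Triangle.congr_other (f := g.1 ∘ T.shift) (g := g.1)
        (fun v hv => by rw [Function.comp_apply, T.shift_of_ne hv]) hx).2]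
  rw [QuadraticMap.comp_apply, QuadraticMap.prod_apply, goeritz_apply, goeritz_apply,
    QuadraticMap.weightedSumSquares_apply, m.sum_eq, T.sum_eq, Finset.sum_congr rfl ho]
  simp only [hd, hd', m.index_corner, a_eq_a_zero ht g.2, Finset.univ_unique,
    Finset.sum_singleton, smul_eq_mul]
  rw [show (default : Unit) = () from rfl, m.transport_snd, hs]
  simp only [add_assoc]
  rw [show (1 : Fin 3) + 1 = 2 from rfl]
  ring

/-- The split-off square has coefficient `±1`. It changes the signature of the form by as much as
the correction changes, and it accounts for the one extra dimension without affecting the radical.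
-/
theorem goeritz_invariants (ht : T.IsWhite t)
    (h : ∃ i, G.index t (T.c i) = 1 ∧ G.index t (T.c (i + 2)) = -1) :
    (sigPos (G.goeritz t) : ℤ) - sigNeg (G.goeritz t) - G.correction t =
      sigPos (H.goeritz (m.colour t)) - sigNeg (H.goeritz (m.colour t)) -
        H.correction (m.colour t) ∧
    (finrank ℝ (G.white t) : ℤ) - sigPos (G.goeritz t) - sigNeg (G.goeritz t) =
      finrank ℝ (H.white (m.colour t)) - sigPos (H.goeritz (m.colour t)) -
        sigNeg (H.goeritz (m.colour t)) := by
  have hb := m.transport_bijective ht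
  have hf := (LinearEquiv.ofBijective _ hb).finrank_eq
  rw [finrank_prod, finrank_fintype_fun_eq_card, Fintype.card_unit] at hf
  have hc := m.correction_sub (t := t)
  have hτ := (star_triangle (fun i => index_eq (t := t) (T.c i)) h).1
  rw [m.goeritz_eq ht h, sigPos_comp_of_surjective _ _ hb.2, sigNeg_comp_of_surjective _ _ hb.2,
    (sig_prod _ _).1, (sig_prod _ _).2, QuadraticForm.sigPos_weightedSumSquares,
    QuadraticForm.sigNeg_weightedSumSquares]
  rcases hτ with hτ | hτ
  · rw [hτ] at hc ⊢
    have hc' : G.correction t - H.correction (m.colour t) = 1 := by exact_mod_cast hc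
    norm_num
    omega
  · rw [hτ] at hc ⊢
    have hc' : G.correction t - H.correction (m.colour t) = -1 := by exact_mod_cast hc
    norm_num
    omega

end TriangleMove

end GaussCode

end

/-! ### Invariance under the third move, and under equivalence of diagrams -/

noncomputable section

namespace GaussCode

/-- The index of a crossing `x` is `1` exactly when the visit `(x, t x)` is over. The `i`-th side
belongs to this visit at `c i` and to the other visit at `c (i + 2)`, so a side over both others
gives opposite indices. -/
theorem Triangle.index_of_over {G : GaussCode} {T : Triangle G} {t : G.Crossing → Bool}
    (ht : T.IsWhite t) {i : Fin 3} (h : G.IsOver (T.a i) ∧ G.IsOver (G.succ (T.a i))) :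
    G.index t (T.c i) = 1 ∧ G.index t (T.c (i + 2)) = -1 := by
  have h1 : G.IsOver (T.c i, t (T.c i)) := by
    rw [ht i, T.first i]
    split_ifs
    exacts [h.2, h.1]
  have h2 : G.IsOver (T.c (i + 2), !t (T.c (i + 2))) := by
    rw [ht (i + 2), T.second (i + 2), Triangle.add_two_add_one]
    split_ifs
    exacts [h.1, h.2]
  unfold IsOver at h1 h2
  constructor
  · rcases realSign_eq (T.c i) with ⟨e1, e2⟩ | ⟨e1, e2⟩ <;>
      rw [e1] at h1 <;> simp at h1 <;> simp [index, e2, h1]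
  · rcases realSign_eq (T.c (i + 2)) with ⟨e1, e2⟩ | ⟨e1, e2⟩ <;>
      rw [e1] at h2 <;> simp at h2 <;> simp [index, e2, h2]

end GaussCode

namespace LinkDiagram

open GaussCode Module

variable {D D' : LinkDiagram}

theorem numPieces_ne_zero (x : D.Crossing) : D.numPieces ≠ 0 := by
  have : Nonempty D.Piece := ⟨Quot.mk _ x⟩
  have : Nat.card D.Piece ≠ 0 := Nat.card_ne_zero.2 ⟨this, inferInstance⟩
  unfold numPieces
  omega

theorem invariants_of_triangleMove {T : Triangle D.toGaussCode}
    (m : TriangleMove T D'.toGaussCode) (hcircles : D'.circles = D.circles)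
    (hover : ∃ i, D.IsOver (T.a i) ∧ D.IsOver (D.succ (T.a i))) : D.invariants = D'.invariants := by
  obtain ⟨t, ht, h0⟩ := D.exists_colouring_eq (T.c 0) (T.s 0 == T.s (0 + 1))
  have hw := T.isWhite_of ht h0
  obtain ⟨i, hi⟩ := hover
  have h := m.goeritz_invariants hw ⟨i, T.index_of_over hw hi⟩
  refine invariants_eq ht (m.isColouring ht) ?_ h.1 (by rw [h.2, hcircles])
  exact iff_of_false (numPieces_ne_zero (T.c 0)) (numPieces_ne_zero (m.e (T.c 0)))

theorem invariants_three (d : Fin 3 → (D.Crossing × Bool) × Bool)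
    (hface : ∀ i, D.faceStep (d i) = d (i + 1))
    (hne : Function.Injective fun i => D.corner (d i))
    (hover : ∃ i, D.IsOver (d i).1 ∧ D.IsOver (D.succ (d i).1))
    (π : Equiv.Perm (D.Crossing × Bool))
    (hπ : π = Equiv.swap (d 0).1 (D.succ (d 0).1) * Equiv.swap (d 1).1 (D.succ (d 1).1) *
      Equiv.swap (d 2).1 (D.succ (d 2).1))
    (e : D.Crossing ≃ D'.Crossing) (hsign : ∀ x, D'.sign (e x) = D.sign x)
    (hsucc : ∀ v, D'.succ (Prod.map e id (π v)) = Prod.map e id (π (D.succ v)))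
    (hcircles : D'.circles = D.circles) : D.invariants = D'.invariants := by
  let T : Triangle D.toGaussCode :=
    { c := fun i => D.corner (d i)
      a := fun i => (d i).1
      s := fun i => (d i).2
      injective := hne
      first := fun i => by
        have := (D.corner_visits (d i)).1
        rwa [hface] at this
      second := fun i => by
        have := (D.corner_visits (d i)).2
        rwa [hface] at this }
  have h1 : ∀ i j, i ≠ j → (d i).1 ≠ (d j).1 := fun i j hij h => hij (T.a_injective h)
  have h2 : ∀ i j, (d i).1 ≠ D.succ (d j).1 := T.a_ne_succ
  have fix : ∀ i v, v ≠ (d i).1 → v ≠ D.succ (d i).1 →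
      Equiv.swap (d i).1 (D.succ (d i).1) v = v := fun i v =>
    Equiv.swap_apply_of_ne_of_ne
  have fix1 : ∀ i j, i ≠ j → Equiv.swap (d j).1 (D.succ (d j).1) (d i).1 = (d i).1 :=
    fun i j hij => fix _ _ (h1 i j hij) (h2 i j)
  have fix2 : ∀ i j, i ≠ j → Equiv.swap (d j).1 (D.succ (d j).1) (D.succ (d i).1) =
      D.succ (d i).1 :=
    fun i j hij => fix _ _ (h2 j i).symm fun h => h1 i j hij (D.succ.injective h)
  let m : TriangleMove T D'.toGaussCode :=
    { π := π
      e := e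
      sign := hsign
      succ := hsucc
      map_a := fun i => by
        show π (d i).1 = D.succ (d i).1
        rw [hπ, Equiv.Perm.mul_apply, Equiv.Perm.mul_apply]
        fin_cases i
        · simp [fix1 0 2, fix1 0 1]
        · simp [fix1 1 2, fix2 1 0]
        · simp [fix2 2 1, fix2 2 0]
      map_succ := fun i => by
        show π (D.succ (d i).1) = (d i).1
        rw [hπ, Equiv.Perm.mul_apply, Equiv.Perm.mul_apply]
        fin_cases i
        · simp [fix2 0 2, fix2 0 1]
        · simp [fix2 1 2, fix1 1 0]
        · simp [fix1 2 1, fix1 2 0]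
      map_other := fun v hv => by
        have hf : ∀ i, Equiv.swap (d i).1 (D.succ (d i).1) v = v := fun i =>
          fix i v (fun h => hv (T.end_mem_corners (i := i) (Or.inl h)))
            (fun h => hv (T.end_mem_corners (i := i) (Or.inr h)))
        rw [hπ, Equiv.Perm.mul_apply, Equiv.Perm.mul_apply, hf, hf, hf] }
  exact invariants_of_triangleMove m hcircles hover

theorem invariants_of_move (h : ReidemeisterMove D D') : D.invariants = D'.invariants := by
  cases h with
  | relabel h => exact invariants_relabel h
  | one d hface h => exact invariants_one d hface h
  | two d₀ d₁ h₀ h₁ hne hover h => exact invariants_two d₀ d₁ h₀ h₁ hne hover h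
  | three d hface hne hover _ π hπ e hsign hsucc hcircles =>
    exact invariants_three d hface hne hover π hπ e hsign hsucc hcircles

theorem invariants_of_link_eq (h : D.link = D'.link) : D.invariants = D'.invariants :=
  congrArg (Quot.lift invariants fun _ _ => invariants_of_move) h

/-! ### Changing a crossing -/

variable (D)

/-- The multiplicity with which a class runs through the band at a crossing. -/
def bandCoefficient (x : D.Crossing) : D.SeifertHomology →ₗ[ℝ] ℝ :=
  (D.boundaries.liftQ (LinearMap.proj x ∘ₗ LinearMap.snd ℝ _ _ ∘ₗ D.cycles.subtype)
    (Submodule.span_le.2 (by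
      rintro _ ⟨C, rfl⟩
      simp [circleCycle]))) ∘ₗ LinearMap.fst ℝ _ _

/-- The quadratic form of the symmetrised Seifert pairing. -/
def seifertForm : QuadraticForm ℝ D.SeifertHomology := D.symmetrisedPairing.toQuadraticMap

/-- The Seifert form after a crossing change, on the same surface cut along the band and reglued. -/
def changedForm (x : D.Crossing) : QuadraticForm ℝ D.SeifertHomology :=
  (D.changeCrossing x).seifertForm

theorem seifertForm_mk (z : D.cycles) (w : Fin (D.numPieces - 1) → ℝ) :
    D.seifertForm (Submodule.Quotient.mk z, w) = 2 * D.linkPush z.1 z.1 := by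
  have h : D.seifertForm (Submodule.Quotient.mk z, w) =
    D.linkPush z.1 z.1 + D.linkPush z.1 z.1 := rfl
  rw [h, two_mul]

theorem changedForm_mk (x : D.Crossing) (z : D.cycles) (w : Fin (D.numPieces - 1) → ℝ) :
    D.changedForm x (Submodule.Quotient.mk z, w) = 2 * (D.changeCrossing x).linkPush z.1 z.1 :=
  (D.changeCrossing x).seifertForm_mk z w

/-- Only the term at `x` changes: the coefficient of the incoming left edge replaces that of the
outgoing one, or conversely, and by conservation of flow these differ by the band coefficient. -/
theorem linkPush_changeCrossing (x : D.Crossing) (z : D.cycles) :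
    (D.changeCrossing x).linkPush z.1 z.1 =
      D.linkPush z.1 z.1 + D.realSign x * (z.1.2 x * z.1.2 x) := by
  have h1 : (D.changeCrossing x).linkPush z.1 z.1 = ∑ y, z.1.2 y *
    (if Function.update D.sign x (-D.sign x) y = 1 then z.1.1 (D.outLeft y)
      else z.1.1 (D.inLeft y)) := rfl
  have h2 : D.linkPush z.1 z.1 = ∑ y, z.1.2 y *
    (if D.sign y = 1 then z.1.1 (D.outLeft y) else z.1.1 (D.inLeft y)) := rfl
  rw [h1, h2, ← sub_eq_iff_eq_add', ← Finset.sum_sub_distrib, Finset.sum_eq_single x]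
  · have h3 := (z.2 x).1
    rw [Function.update_self, h3]
    rcases realSign_eq x with ⟨e1, e2⟩ | ⟨e1, e2⟩ <;> rw [e1, e2] <;> simp <;> ring
  · intro y _ hy
    rw [Function.update_of_ne hy, sub_self]
  · simp

theorem changedForm_apply (x : D.Crossing) (v : D.SeifertHomology) :
    D.changedForm x v = D.seifertForm v +
      D.realSign x * (2 * (D.bandCoefficient x v * D.bandCoefficient x v)) := by
  obtain ⟨q, w⟩ := v
  induction q using Submodule.Quotient.induction_on with
  | _ z =>
    have h : D.bandCoefficient x (Submodule.Quotient.mk z, w) = z.1.2 x := rfl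
    rw [changedForm_mk, seifertForm_mk, linkPush_changeCrossing, h]
    ring

theorem signature_add_nullity :
    D.signature + D.nullity = finrank ℝ D.DiscBandHomology + (D.numPieces - 1 : ℕ) -
      2 * sigNeg D.seifertForm := by
  have h1 := D.nullity_add_sig
  have h2 : D.signature = (sigPos D.seifertForm : ℤ) - sigNeg D.seifertForm := rfl
  unfold seifertForm at *
  omega

theorem signature_sub_nullity :
    D.signature - D.nullity = 2 * sigPos D.seifertForm -
      (finrank ℝ D.DiscBandHomology + (D.numPieces - 1 : ℕ)) := by
  have h1 := D.nullity_add_sig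
  have h2 : D.signature = (sigPos D.seifertForm : ℤ) - sigNeg D.seifertForm := rfl
  unfold seifertForm at *
  omega

theorem signature_add_nullity_changeCrossing (x : D.Crossing) :
    (D.changeCrossing x).signature + (D.changeCrossing x).nullity =
      finrank ℝ D.DiscBandHomology + (D.numPieces - 1 : ℕ) - 2 * sigNeg (D.changedForm x) :=
  (D.changeCrossing x).signature_add_nullity

theorem signature_sub_nullity_changeCrossing (x : D.Crossing) :
    (D.changeCrossing x).signature - (D.changeCrossing x).nullity =
      2 * sigPos (D.changedForm x) - (finrank ℝ D.DiscBandHomology + (D.numPieces - 1 : ℕ)) :=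
  (D.changeCrossing x).signature_sub_nullity

theorem changeCrossing_of_negative {x : D.Crossing} (hx : D.sign x = -1) :
    ((D.changeCrossing x).signature + (D.changeCrossing x).nullity = D.signature + D.nullity ∨
      (D.changeCrossing x).signature + (D.changeCrossing x).nullity =
        D.signature + D.nullity - 2) ∧
    ((D.changeCrossing x).signature - (D.changeCrossing x).nullity = D.signature - D.nullity ∨
      (D.changeCrossing x).signature - (D.changeCrossing x).nullity =
        D.signature - D.nullity - 2) := by
  have h := sig_sub_sq D.seifertForm (D.changedForm x) (D.bandCoefficient x) fun v => by
    rw [changedForm_apply, realSign, hx]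
    push_cast
    ring
  rw [signature_add_nullity_changeCrossing, signature_sub_nullity_changeCrossing,
    signature_add_nullity, signature_sub_nullity]
  omega

theorem changeCrossing_of_positive {x : D.Crossing} (hx : D.sign x = 1) :
    ((D.changeCrossing x).signature + (D.changeCrossing x).nullity = D.signature + D.nullity ∨
      (D.changeCrossing x).signature + (D.changeCrossing x).nullity =
        D.signature + D.nullity + 2) ∧
    ((D.changeCrossing x).signature - (D.changeCrossing x).nullity = D.signature - D.nullity ∨
      (D.changeCrossing x).signature - (D.changeCrossing x).nullity =
        D.signature - D.nullity + 2) := by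
  -- The roles of the two forms are exchanged, since here the change adds a square.
  have h := sig_sub_sq (D.changedForm x) D.seifertForm (D.bandCoefficient x) fun v => by
    rw [changedForm_apply, realSign, hx]
    push_cast
    ring
  rw [signature_add_nullity_changeCrossing, signature_sub_nullity_changeCrossing,
    signature_add_nullity, signature_sub_nullity]
  omega

end LinkDiagram

end

/-- `D` and `D'` are arbitrary diagrams of the oriented links `L` and `L'`, so `D.signature` and
`D.nullity` are the signature and the nullity of `L`, and likewise for `L'`. -/
theorem mainTheorem10 (L L' : OrientedLink)
    (D D' : LinkDiagram) (hD : D.link = L) (hD' : D'.link = L') :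
    (OrientedLink.CrossingChange (-1) L L' →
      D'.signature + D'.nullity ∈
        ({D.signature + D.nullity, D.signature + D.nullity - 2} : Set ℤ) ∧
      D'.signature - D'.nullity ∈
        ({D.signature - D.nullity, D.signature - D.nullity - 2} : Set ℤ)) ∧
    (OrientedLink.CrossingChange 1 L L' →
      D'.signature + D'.nullity ∈
        ({D.signature + D.nullity, D.signature + D.nullity + 2} : Set ℤ) ∧
      D'.signature - D'.nullity ∈
        ({D.signature - D.nullity, D.signature - D.nullity + 2} : Set ℤ)) ∧
    (OrientedLink.CrossingChange (-1) L L' ∨ OrientedLink.CrossingChange 1 L L' →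
      |D'.nullity - D.nullity| ≤ 1) := by
  have neg : OrientedLink.CrossingChange (-1) L L' →
      (D'.signature + D'.nullity = D.signature + D.nullity ∨
        D'.signature + D'.nullity = D.signature + D.nullity - 2) ∧
      (D'.signature - D'.nullity = D.signature - D.nullity ∨
        D'.signature - D'.nullity = D.signature - D.nullity - 2) := by
    rintro ⟨D₀, x, hx, h, h'⟩
    have h1 := LinkDiagram.invariants_of_link_eq (hD.trans h.symm)
    have h2 := LinkDiagram.invariants_of_link_eq (hD'.trans h'.symm)
    simp only [LinkDiagram.invariants, Prod.mk.injEq] at h1 h2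
    rw [h1.1, h1.2, h2.1, h2.2]
    exact D₀.changeCrossing_of_negative hx
  have pos : OrientedLink.CrossingChange 1 L L' →
      (D'.signature + D'.nullity = D.signature + D.nullity ∨
        D'.signature + D'.nullity = D.signature + D.nullity + 2) ∧
      (D'.signature - D'.nullity = D.signature - D.nullity ∨
        D'.signature - D'.nullity = D.signature - D.nullity + 2) := by
    rintro ⟨D₀, x, hx, h, h'⟩
    have h1 := LinkDiagram.invariants_of_link_eq (hD.trans h.symm)
    have h2 := LinkDiagram.invariants_of_link_eq (hD'.trans h'.symm)
    simp only [LinkDiagram.invariants, Prod.mk.injEq] at h1 h2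
    rw [h1.1, h1.2, h2.1, h2.2]
    exact D₀.changeCrossing_of_positive hx
  refine ⟨neg, pos, fun h => ?_⟩
  -- Twice the change of the nullity is the change of the sum minus that of the difference, hence
  -- lies between `-2` and `2`.
  rw [abs_le]
  rcases h with h | h
  · have := neg h
    omega
  · have := pos h
    omega
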